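/- A graph here is a finite loopless graph, possibly with multiple edges, on the vertex set $[n]=\{1,\dots,n\}$; every edge is a unit resistor, $e(G)$ is the number of edges and $R_{xy}$ is the effective resistance between $x$ and $y$. For a connected graph $G$ put $$A(G)=\binom n2^{-1}\sum_{x<y}R_{xy},\qquad A'(G)=\frac1{n^2}\sum_{x,y}R_{xy},$$ and $A(G)=A'(G)=\infty$ if $G$ is disconnected. Let $a_n(\alpha)=\min\{A'(G): |V(G)|=n,\ e(G)\le \alpha n/2\}$ and $a(\alpha)=\lim_{n\to\infty}a_n(\alpha)$. A leaf is a vertex of degree one. A graph on $[n]$ is optimal (for $\alpha$) if it minimises $A$ among all graphs on $[n]$ with at most $\alpha n/2$ edges. **Lemma 8.1.** For every $\alpha\ge 3.83$ the limit $a(\alpha)$ exists. If $\alpha\ge 3.83$ and $G$ is a connected graph on $n$ vertices with $e(G)\le\alpha n/2$ (in particular, if $G$ has average degree $\alpha$) and with $\gamma n$ leaves, then $$A(G)-a(\alpha)\ \ge\ \frac{\gamma}{100}+o(1).$$ In particular, optimal graphs have $o(n)$ leaves. Both $o(1)$ and $o(n)$ are as $n\to\infty$, uniformly over all $\alpha\ge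 3.83$ and all such graphs $G$: for every $\varepsilon>0$ there is $N$ such that for all $n\ge N$ and all $\alpha\ge 3.83$, every connected graph $G$ on $[n]$ with $e(G)\le\alpha n/2$ and $\gamma n$ leaves satisfies $A(G)-a(\alpha)\ge\gamma/100-\varepsilon$, and every optimal graph on $[n]$ for $\alpha$ has at most $\varepsilon n$ leaves. -/

import Mathlib

/-- A finite graph on the vertex set `V`, possibly with multiple edges (and without loops): `mult x y`
is the number of edges joining `x` and `y`. Every edge is regarded as a unit resistor. -/
structure Multigraph (V : Type*) where
  mult : V → V → ℕ
  symm : ∀ x y, mult x y = mult y x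
  loopless : ∀ x, mult x x = 0

namespace Multigraph

/-- The simple graph in which two vertices are adjacent if some edge joins them. -/
def toSimple {V : Type*} (G : Multigraph V) : SimpleGraph V where
  Adj x y := 0 < G.mult x y
  symm := ⟨fun x y h => by rw [G.symm y x]; exact h⟩
  loopless := ⟨fun x h => by simp [G.loopless x] at h⟩

/-- `G` is connected. -/
def Connected {V : Type*} (G : Multigraph V) : Prop := G.toSimple.Connected

/-- The degree of a vertex: the number of edges at it, counted with multiplicity. -/
def degree {V : Type*} [Fintype V] (G : Multigraph V) (x : V) : ℕ := ∑ y, G.mult x y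

/-- The number of leaves, that is, of vertices of degree one. -/
def numLeaves {V : Type*} [Fintype V] (G : Multigraph V) : ℕ :=
  (Finset.univ.filter fun x => G.degree x = 1).card

/-- The number `e(G)` of edges of a graph with vertex set `[n]`, counted with multiplicity. -/
def numEdges {n : ℕ} (G : Multigraph (Fin n)) : ℕ :=
  ∑ x, ∑ y ∈ Finset.Ioi x, G.mult x y

/-- `P` is a system of potentials for the current flow in which a unit current enters the network
at `x` and leaves it at `y`. By Ohm's law each edge `uw` carries the current `P u - P w` from `u` to
`w`, and by Kirchhoff's current law the total current flowing from `u` into the edges at `u` is the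
current that enters the network at `u` from outside. -/
def IsUnitPotential {V : Type*} [Fintype V] [DecidableEq V] (G : Multigraph V) (x y : V)
    (P : V → ℝ) : Prop :=
  ∀ u, ∑ w, (G.mult u w : ℝ) * (P u - P w) =
    (if u = x then 1 else 0) - (if u = y then 1 else 0)

open Classical in
/-- The effective resistance `R_xy`: the potential difference `P x - P y` for the current flow in
which a unit current enters at `x` and leaves at `y`. The value does not depend on the choice of
`P` (`effRes_eq`). In a connected graph such potentials always exist; the definition is only used
for connected graphs. -/
noncomputable def effRes {V : Type*} [Fintype V] [DecidableEq V] (G : Multigraph V) (x y : V) : ℝ :=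
  if h : ∃ P, G.IsUnitPotential x y P then h.choose x - h.choose y else 0

/-- The average resistance `A(G)` over unordered pairs of distinct vertices of a connected graph
with vertex set `[n]`. -/
noncomputable def avgRes {n : ℕ} (G : Multigraph (Fin n)) : ℝ :=
  (∑ x, ∑ y ∈ Finset.Ioi x, G.effRes x y) / (n.choose 2 : ℝ)

/-- The average resistance `A'(G)` over all ordered pairs of vertices of a connected graph with
vertex set `[n]`. -/
noncomputable def avgRes' {n : ℕ} (G : Multigraph (Fin n)) : ℝ :=
  (∑ x, ∑ y, G.effRes x y) / (n : ℝ) ^ 2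

/-- The admissible graphs with parameters `n` and `α`: connected graphs on `[n]` with at most
`α n / 2` edges. (A disconnected graph has infinite average resistance, so it never plays a role in
a minimum.) -/
def Admissible {n : ℕ} (α : ℝ) (G : Multigraph (Fin n)) : Prop :=
  G.Connected ∧ (G.numEdges : ℝ) ≤ α * n / 2

/-- `G` is optimal: it minimises the average resistance among all graphs on `[n]` with at most
`α n / 2` edges. -/
def IsOptimal {n : ℕ} (α : ℝ) (G : Multigraph (Fin n)) : Prop :=
  G.Admissible α ∧ ∀ H : Multigraph (Fin n), H.Admissible α → G.avgRes ≤ H.avgRes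

/-- `a_n(α)`, the minimum of `A'(G)` over all graphs `G` on `[n]` with at most `α n / 2` edges. -/
noncomputable def aSeq (n : ℕ) (α : ℝ) : ℝ :=
  sInf {r | ∃ G : Multigraph (Fin n), G.Admissible α ∧ G.avgRes' = r}

/-- `a(α)`, the limit of `a_n(α)` as `n → ∞`. -/
noncomputable def aLim (α : ℝ) : ℝ := Filter.limUnder Filter.atTop fun n : ℕ => aSeq n α

theorem IsUnitPotential.sub_eq {V : Type*} [Fintype V] [DecidableEq V] {G : Multigraph V}
    {x y : V} {P Q : V → ℝ} (hP : G.IsUnitPotential x y P) (hQ : G.IsUnitPotential x y Q) :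
    P x - P y = Q x - Q y := by
  have key : ∀ S T : V → ℝ, G.IsUnitPotential x y T →
      ∑ u, ∑ w, (G.mult u w : ℝ) * (S u * (T u - T w)) = S x - S y := by
    intro S T hT
    have h1 : ∀ u, ∑ w, (G.mult u w : ℝ) * (S u * (T u - T w)) =
        S u * ((if u = x then 1 else 0) - (if u = y then 1 else 0)) := by
      intro u
      rw [← hT u, Finset.mul_sum]
      exact Finset.sum_congr rfl fun w _ => by ring
    rw [Finset.sum_congr rfl fun u _ => h1 u]
    simp [mul_sub]
  have hsw : ∑ u, ∑ w, (G.mult u w : ℝ) * (P u * Q w) =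
      ∑ u, ∑ w, (G.mult u w : ℝ) * (Q u * P w) := by
    rw [Finset.sum_comm]
    refine Finset.sum_congr rfl fun u _ => Finset.sum_congr rfl fun w _ => ?_
    rw [G.symm w u]; ring
  rw [← key P Q hQ, ← key Q P hP]
  simp only [mul_sub, Finset.sum_sub_distrib]
  rw [hsw]
  simp only [mul_comm (P _) (Q _)]

/-- The effective resistance is well defined. -/
theorem effRes_eq {V : Type*} [Fintype V] [DecidableEq V] {G : Multigraph V} {x y : V}
    {P : V → ℝ} (hP : G.IsUnitPotential x y P) : G.effRes x y = P x - P y := by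
  have hex : ∃ Q, G.IsUnitPotential x y Q := ⟨P, hP⟩
  have h2 : G.effRes x y = hex.choose x - hex.choose y := by
    simp only [effRes, dif_pos hex]
  rw [h2]
  exact IsUnitPotential.sub_eq hex.choose_spec hP

end Multigraph

/-!
Write `T(G)` for the sum of the effective resistances over all ordered pairs of vertices, so that
`A'(G) = T(G) / n²`. Four facts about it carry the proof.

*Leaves are expensive* (`Connected.totalRes_ge`). Let `C` be the core of `G`, that is, `G` without
its `γ n` leaves, and `m = (1 - γ) n` the order of `C`. A leaf at `v` has resistance `1 + R_vy` to a
vertex `y` of `C`, and the mean of `R_vy` over `y` is at least `A'(C) / 2` for every `v`, since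
effective resistances are squared Euclidean distances. Hence `A(G) ≥ 2γ + (1 - γ) A'(C)`.

*Edges are cheap* (`Connected.exists_deleteEdge`). Deleting an edge with effective resistance `R_e`
adds `i² / (1 - R_e)` to the resistance between `x` and `y`, where `i` is the current through the
edge. Averaging over the edges with weights `1 - R_e`, which by Foster's theorem sum to the
cyclomatic number `β = e - n + 1`, yields an edge whose deletion multiplies `T` by at most
`(β + 1) / β`. The core has `(α / 2 - 1) γ n` edges more than average degree `α` allows; deleting them
costs a factor of about `1 / (1 - γ)`.

*Good graphs can be copied* (`Connected.exists_isHubBound`, `IsHubBound.totalRes_le`). Join each of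
`k` copies of a graph `H` on `n` vertices to a common hub by `t` edges, where `1 ≪ t ≪ n`, whose
ends are chosen so that their centre of gravity (in the Euclidean picture) is close to that of `H`.
The mean resistance to the hub is then about `A'(H) / 2`, so the resulting graph has average
resistance about `A'(H)`; a few leaves at the hub pay for the additional edges. So `a(α)` exists and
`a(α) ≤ A'(H) + o(1)`, uniformly in `α`.

*The limit is less than one* (`aLim_le`). Wheels with six spokes sharing their hub, with some leaves
at the hub, have average degree `3.83` and average resistance `0.9935`.

Together, `A(G) ≥ 2γ + (1 - γ)² a(α) + o(1) ≥ a(α) + 2γ (1 - a(α)) + o(1)`, and `1 - a(α) ≥ 0.006`.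
For optimal graphs one also needs that `a_n(α) ≤ a(α) + o(1)` uniformly in `α`: this follows from
monotonicity in `α` and from the continuity of `a`, which is again a consequence of the cheap
deletion of edges (`aLim_mul_le`).
-/

namespace Multigraph

/-! ### Energy, potentials and the Green function -/

section Electrical

variable {V : Type*} [Fintype V]

/-- The graph Laplacian: `lap G f u` is the net current that leaves `u` under the potential `f`. -/
def lap (G : Multigraph V) (f : V → ℝ) (u : V) : ℝ := ∑ w, (G.mult u w : ℝ) * (f u - f w)

/-- The mutual energy (Dirichlet form) of two potentials. The sum runs over ordered pairs, so that
every edge is counted twice, whence the factor `1 / 2`. -/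
noncomputable def energyForm (G : Multigraph V) (f g : V → ℝ) : ℝ :=
  (∑ u, ∑ w, (G.mult u w : ℝ) * ((f u - f w) * (g u - g w))) / 2

/-- The energy of a potential: the sum of squared differences over the edges. -/
noncomputable def energy (G : Multigraph V) (f : V → ℝ) : ℝ :=
  (∑ u, ∑ w, (G.mult u w : ℝ) * (f u - f w) ^ 2) / 2

/-- The sum of the degrees, that is, twice the number of edges. -/
def degSum (G : Multigraph V) : ℕ := ∑ x, ∑ y, G.mult x y

theorem energyForm_self (G : Multigraph V) (f : V → ℝ) : G.energyForm f f = G.energy f := by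
  simp [energyForm, energy, sq]

theorem energy_nonneg (G : Multigraph V) (f : V → ℝ) : 0 ≤ G.energy f := by
  unfold energy; positivity

theorem sum_mul_lap (G : Multigraph V) (f g : V → ℝ) :
    ∑ u, f u * G.lap g u = G.energyForm f g := by
  have h1 : ∑ u, f u * G.lap g u = ∑ u, ∑ w, (G.mult u w : ℝ) * (f u * (g u - g w)) := by
    refine Finset.sum_congr rfl fun u _ => ?_
    rw [lap, Finset.mul_sum]
    exact Finset.sum_congr rfl fun w _ => by ring
  have h2 : ∑ u, f u * G.lap g u = ∑ u, ∑ w, (G.mult u w : ℝ) * (f w * (g w - g u)) := by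
    rw [h1, Finset.sum_comm]
    refine Finset.sum_congr rfl fun u _ => Finset.sum_congr rfl fun w _ => ?_
    rw [G.symm w u]
  have h3 : ∑ u, f u * G.lap g u + ∑ u, f u * G.lap g u = 2 * G.energyForm f g := by
    nth_rewrite 1 [h1]
    rw [h2, energyForm, mul_div_cancel₀ _ two_ne_zero, ← Finset.sum_add_distrib]
    refine Finset.sum_congr rfl fun u _ => ?_
    rw [← Finset.sum_add_distrib]
    exact Finset.sum_congr rfl fun w _ => by ring
  linarith

theorem energyForm_comm (G : Multigraph V) (f g : V → ℝ) :
    G.energyForm f g = G.energyForm g f := by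
  unfold energyForm
  simp only [mul_comm (f _ - f _)]

theorem energyForm_sq_le (G : Multigraph V) (f g : V → ℝ) :
    G.energyForm f g ^ 2 ≤ G.energy f * G.energy g := by
  have h := Finset.sum_sq_le_sum_mul_sum_of_sq_le_mul (Finset.univ : Finset (V × V))
    (r := fun p => (G.mult p.1 p.2 : ℝ) * ((f p.1 - f p.2) * (g p.1 - g p.2)))
    (f := fun p => (G.mult p.1 p.2 : ℝ) * (f p.1 - f p.2) ^ 2)
    (g := fun p => (G.mult p.1 p.2 : ℝ) * (g p.1 - g p.2) ^ 2)
    (fun p _ => by positivity) (fun p _ => by positivity) (fun p _ => le_of_eq (by ring))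
  simp only [Fintype.sum_prod_type] at h
  unfold energyForm energy
  rw [div_pow, div_mul_div_comm]
  norm_num only
  linarith

theorem sum_lap (G : Multigraph V) (f : V → ℝ) : ∑ u, G.lap f u = 0 := by
  have := G.sum_mul_lap (fun _ => 1) f
  simpa [energyForm] using this

theorem Connected.eq_of_energy_eq_zero {G : Multigraph V} (hG : G.Connected) {f : V → ℝ}
    (hf : G.energy f = 0) (x y : V) : f x = f y := by
  have h0 : ∑ u, ∑ w, (G.mult u w : ℝ) * (f u - f w) ^ 2 = 0 := by
    unfold energy at hf; linarith
  have h1 : ∀ u w, (G.mult u w : ℝ) * (f u - f w) ^ 2 = 0 := by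
    intro u w
    rw [Finset.sum_eq_zero_iff_of_nonneg (fun u _ => by positivity)] at h0
    have h2 := h0 u (Finset.mem_univ u)
    rw [Finset.sum_eq_zero_iff_of_nonneg (fun u _ => by positivity)] at h2
    exact h2 w (Finset.mem_univ w)
  obtain ⟨p⟩ := hG.preconnected x y
  induction p with
  | nil => rfl
  | cons h p ih =>
    rename_i u v w
    have h' : (G.mult u v : ℝ) ≠ 0 := by
      have : 0 < G.mult u v := h
      positivity
    have h3 := h1 u v
    simp only [mul_eq_zero, h', false_or, ne_eq, OfNat.ofNat_ne_zero, not_false_eq_true,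
      pow_eq_zero_iff] at h3
    linarith

theorem connected_of_energy [Nonempty V] {G : Multigraph V}
    (h : ∀ f : V → ℝ, G.energy f = 0 → ∀ x y, f x = f y) : G.Connected := by
  classical
  refine ⟨fun x y => ?_⟩
  have h1 := h (fun z => if G.toSimple.Reachable x z then 1 else 0) ?_ x y
  · by_contra hxy
    simp [hxy] at h1
  · unfold energy
    rw [div_eq_zero_iff]
    left
    refine Finset.sum_eq_zero fun u _ => Finset.sum_eq_zero fun w _ => ?_
    rcases Nat.eq_zero_or_pos (G.mult u w) with h0 | h0
    · simp [h0]
    · have hadj : G.toSimple.Adj u w := h0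
      have : G.toSimple.Reachable x u ↔ G.toSimple.Reachable x w :=
        ⟨fun h => h.trans hadj.reachable, fun h => h.trans hadj.symm.reachable⟩
      simp [this]

variable [DecidableEq V]

theorem isUnitPotential_iff {G : Multigraph V} {x y : V} {P : V → ℝ} :
    G.IsUnitPotential x y P ↔
      ∀ u, G.lap P u = (if u = x then 1 else 0) - (if u = y then 1 else 0) := Iff.rfl

theorem IsUnitPotential.energyForm {G : Multigraph V} {x y : V} {P : V → ℝ}
    (hP : G.IsUnitPotential x y P) (f : V → ℝ) : G.energyForm f P = f x - f y := by
  rw [← sum_mul_lap, Finset.sum_congr rfl fun u _ => by rw [isUnitPotential_iff.1 hP u]]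
  simp [mul_sub]

theorem IsUnitPotential.effRes_eq_energy {G : Multigraph V} {x y : V} {P : V → ℝ}
    (hP : G.IsUnitPotential x y P) : G.effRes x y = G.energy P := by
  rw [effRes_eq hP, ← energyForm_self, hP.energyForm]

/-- A graph in which every pair of vertices admits a unit current flow is connected. -/
theorem connected_of_isUnitPotential [Nonempty V] {G : Multigraph V}
    (h : ∀ x y, ∃ P, G.IsUnitPotential x y P) : G.Connected := by
  refine connected_of_energy fun f hf x y => ?_
  obtain ⟨P, hP⟩ := h x y
  have h1 := G.energyForm_sq_le f P
  rw [hf, zero_mul, hP.energyForm] at h1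
  have : f x - f y = 0 := by nlinarith [sq_nonneg (f x - f y)]
  linarith

/-- `M` is the Green function of `G`: `M x` is the potential, normalised to have sum zero, of the
current flow in which a unit current enters at `x` and leaves evenly through all the vertices.
As a matrix, `M` is the pseudoinverse of the Laplacian. -/
structure IsGreen (G : Multigraph V) (M : V → V → ℝ) : Prop where
  symm : ∀ x y, M x y = M y x
  sum_eq_zero : ∀ x, ∑ y, M x y = 0
  lap_eq : ∀ x u, G.lap (M x) u = (if u = x then 1 else 0) - 1 / (Fintype.card V : ℝ)

theorem Connected.exists_isGreen {G : Multigraph V} (hG : G.Connected) : ∃ M, G.IsGreen M := by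
  have hne : Nonempty V := hG.nonempty
  have hn : (0 : ℝ) < Fintype.card V := by exact_mod_cast Fintype.card_pos
  -- adding the sum of the values makes the Laplacian invertible
  let Λ : (V → ℝ) →ₗ[ℝ] (V → ℝ) :=
    { toFun := fun f u => G.lap f u + ∑ w, f w
      map_add' := by
        intro f g
        ext u
        simp only [lap, Pi.add_apply, Finset.sum_add_distrib, mul_sub, mul_add,
          Finset.sum_sub_distrib]
        ring
      map_smul' := by
        intro c f
        ext u
        simp only [lap, Pi.smul_apply, smul_eq_mul, RingHom.id_apply, mul_add, Finset.mul_sum]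
        congr 1
        exact Finset.sum_congr rfl fun w _ => by ring }
  have hΛ : ∀ f u, Λ f u = G.lap f u + ∑ w, f w := fun _ _ => rfl
  have hsum : ∀ f, ∑ u, Λ f u = Fintype.card V * ∑ w, f w := by
    intro f
    simp [hΛ, Finset.sum_add_distrib, sum_lap]
  have hinj : Function.Injective Λ := by
    rw [injective_iff_map_eq_zero]
    intro f hf
    have h0 : ∑ w, f w = 0 := by
      have := hsum f
      rw [hf] at this
      simpa [hn.ne'] using this.symm
    have h1 : G.energy f = 0 := by
      rw [← energyForm_self, ← sum_mul_lap]
      refine Finset.sum_eq_zero fun u _ => ?_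
      have := hΛ f u
      rw [hf, h0] at this
      have h2 : G.lap f u = 0 := by simpa using this.symm
      rw [h2, mul_zero]
    ext u
    have h2 : ∑ w, f w = ∑ _w : V, f u :=
      Finset.sum_congr rfl fun w _ => hG.eq_of_energy_eq_zero h1 w u
    rw [h0] at h2
    simpa [hn.ne'] using h2.symm
  have hsurj := LinearMap.injective_iff_surjective.1 hinj
  choose g hg using fun x : V => hsurj (Pi.single x 1)
  have hgs : ∀ x, ∑ w, g x w = 1 / (Fintype.card V : ℝ) := by
    intro x
    have := hsum (g x)
    rw [hg] at this
    simp only [Finset.sum_pi_single', Finset.mem_univ, if_true] at this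
    field_simp
    linarith
  have hlap : ∀ x u, G.lap (fun y => g x y - 1 / (Fintype.card V : ℝ) ^ 2) u =
      (if u = x then 1 else 0) - 1 / (Fintype.card V : ℝ) := by
    intro x u
    have h1 := hΛ (g x) u
    rw [hg, hgs, Pi.single_apply] at h1
    have h2 : G.lap (fun y => g x y - 1 / (Fintype.card V : ℝ) ^ 2) u = G.lap (g x) u := by
      simp [lap]
    rw [h2, h1]
    ring
  have hz : ∀ x, ∑ y, (g x y - 1 / (Fintype.card V : ℝ) ^ 2) = 0 := by
    intro x
    rw [Finset.sum_sub_distrib, hgs]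
    simp only [Finset.sum_const, Finset.card_univ, nsmul_eq_mul]
    field_simp
    ring
  refine ⟨fun x y => g x y - 1 / (Fintype.card V : ℝ) ^ 2, ?_, hz, hlap⟩
  have key : ∀ x y, G.energyForm (fun w => g y w - 1 / (Fintype.card V : ℝ) ^ 2)
      (fun w => g x w - 1 / (Fintype.card V : ℝ) ^ 2) =
      g y x - 1 / (Fintype.card V : ℝ) ^ 2 := by
    intro x y
    rw [← sum_mul_lap, Finset.sum_congr rfl fun u _ => by rw [hlap x u, mul_sub],
      Finset.sum_sub_distrib, ← Finset.sum_mul, hz]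
    simp
  intro x y
  rw [← key x y, ← key y x, energyForm_comm]

namespace IsGreen

variable {G : Multigraph V} {M : V → V → ℝ}

theorem sum_mul_lap_sum (hM : G.IsGreen M) {d : V → ℝ} (hd : ∑ x, d x = 0) (u : V) :
    G.lap (fun w => ∑ x, d x * M x w) u = d u := by
  have h1 : G.lap (fun w => ∑ x, d x * M x w) u = ∑ x, d x * G.lap (M x) u := by
    simp only [lap, Finset.mul_sum, ← Finset.sum_sub_distrib]
    rw [Finset.sum_comm]
    exact Finset.sum_congr rfl fun x _ => Finset.sum_congr rfl fun w _ => by ring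
  rw [h1, Finset.sum_congr rfl fun x _ => by rw [hM.lap_eq x u, mul_sub],
    Finset.sum_sub_distrib, ← Finset.sum_mul, hd]
  simp

/-- Thomson's principle: the energy needed to route the demand `d` bounds the ratio of
`(∑ d f)²` to the energy of `f`. -/
theorem sq_sum_mul_le (hM : G.IsGreen M) {d : V → ℝ} (hd : ∑ x, d x = 0) (f : V → ℝ) :
    (∑ x, d x * f x) ^ 2 ≤ (∑ x, ∑ y, d x * d y * M x y) * G.energy f := by
  have h1 := G.energyForm_sq_le f (fun w => ∑ x, d x * M x w)
  have h2 : ∀ h : V → ℝ, G.energyForm h (fun w => ∑ x, d x * M x w) = ∑ x, d x * h x := by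
    intro h
    rw [← sum_mul_lap]
    exact Finset.sum_congr rfl fun u _ => by rw [hM.sum_mul_lap_sum hd, mul_comm]
  rw [h2, ← energyForm_self _ (fun w => ∑ x, d x * M x w), h2, mul_comm] at h1
  refine h1.trans (le_of_eq ?_)
  congr 1
  refine Finset.sum_congr rfl fun x _ => ?_
  rw [Finset.mul_sum]
  exact Finset.sum_congr rfl fun y _ => by rw [hM.symm x y]; ring

theorem quadForm_nonneg (hM : G.IsGreen M) {d : V → ℝ} (hd : ∑ x, d x = 0) :
    0 ≤ ∑ x, ∑ y, d x * d y * M x y := by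
  have h1 := G.energy_nonneg (fun w => ∑ x, d x * M x w)
  rw [← energyForm_self, ← sum_mul_lap, Finset.sum_congr rfl fun u _ => by
    rw [hM.sum_mul_lap_sum hd u, Finset.sum_mul]] at h1
  refine h1.trans (le_of_eq ?_)
  refine Finset.sum_congr rfl fun x _ => ?_
  exact Finset.sum_congr rfl fun y _ => by rw [hM.symm x y]; ring

theorem diag_nonneg (hM : G.IsGreen M) (x : V) : 0 ≤ M x x := by
  have h1 := G.energy_nonneg (M x)
  rw [← energyForm_self, ← sum_mul_lap, Finset.sum_congr rfl fun u _ => by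
    rw [hM.lap_eq x u, mul_sub], Finset.sum_sub_distrib, ← Finset.sum_mul,
    hM.sum_eq_zero] at h1
  simpa using h1

theorem isUnitPotential (hM : G.IsGreen M) (x y : V) :
    G.IsUnitPotential x y (fun u => M x u - M y u) := by
  rw [isUnitPotential_iff]
  intro u
  have : G.lap (fun u => M x u - M y u) u = G.lap (M x) u - G.lap (M y) u := by
    simp only [lap, ← Finset.sum_sub_distrib]
    exact Finset.sum_congr rfl fun w _ => by ring
  rw [this, hM.lap_eq, hM.lap_eq]
  ring

theorem effRes_eq (hM : G.IsGreen M) (x y : V) :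
    G.effRes x y = M x x + M y y - 2 * M x y := by
  rw [Multigraph.effRes_eq (hM.isUnitPotential x y)]
  simp only [hM.symm y x]
  ring

theorem sum_effRes (hM : G.IsGreen M) (x : V) :
    ∑ y, G.effRes x y = Fintype.card V * M x x + ∑ y, M y y := by
  simp only [hM.effRes_eq, Finset.sum_sub_distrib, Finset.sum_add_distrib, ← Finset.mul_sum,
    hM.sum_eq_zero]
  simp

end IsGreen

/-- The sum of the effective resistances over all ordered pairs of vertices. -/
noncomputable def totalRes (G : Multigraph V) : ℝ := ∑ x, ∑ y, G.effRes x y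

theorem IsGreen.totalRes_eq {G : Multigraph V} {M : V → V → ℝ} (hM : G.IsGreen M) :
    G.totalRes = 2 * Fintype.card V * ∑ x, M x x := by
  simp only [totalRes, hM.sum_effRes, Finset.sum_add_distrib, ← Finset.mul_sum]
  simp
  ring

theorem Connected.exists_isUnitPotential {G : Multigraph V} (hG : G.Connected) (x y : V) :
    ∃ P, G.IsUnitPotential x y P := by
  obtain ⟨M, hM⟩ := hG.exists_isGreen
  exact ⟨_, hM.isUnitPotential x y⟩

theorem Connected.effRes_nonneg {G : Multigraph V} (hG : G.Connected) (x y : V) :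
    0 ≤ G.effRes x y := by
  obtain ⟨P, hP⟩ := hG.exists_isUnitPotential x y
  rw [hP.effRes_eq_energy]
  exact G.energy_nonneg P

theorem Connected.effRes_comm {G : Multigraph V} (hG : G.Connected) (x y : V) :
    G.effRes x y = G.effRes y x := by
  obtain ⟨M, hM⟩ := hG.exists_isGreen
  rw [hM.effRes_eq, hM.effRes_eq, hM.symm x y]
  ring

theorem Connected.effRes_self {G : Multigraph V} (hG : G.Connected) (x : V) :
    G.effRes x x = 0 := by
  obtain ⟨M, hM⟩ := hG.exists_isGreen
  rw [hM.effRes_eq]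
  ring

theorem Connected.totalRes_nonneg {G : Multigraph V} (hG : G.Connected) : 0 ≤ G.totalRes :=
  Finset.sum_nonneg fun x _ => Finset.sum_nonneg fun y _ => hG.effRes_nonneg x y

/-- Dirichlet's principle, as an upper bound for the effective resistance. -/
theorem Connected.effRes_le {G : Multigraph V} (hG : G.Connected) {x y : V} {K : ℝ} (hK : 0 ≤ K)
    (h : ∀ f : V → ℝ, (f x - f y) ^ 2 ≤ K * G.energy f) : G.effRes x y ≤ K := by
  obtain ⟨P, hP⟩ := hG.exists_isUnitPotential x y
  have h1 := h P
  rw [← hP.effRes_eq_energy, ← effRes_eq hP] at h1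
  by_contra hlt
  push Not at hlt
  nlinarith

/-- Foster's theorem, summed over ordered pairs. -/
theorem Connected.foster {G : Multigraph V} (hG : G.Connected) :
    ∑ u, ∑ w, (G.mult u w : ℝ) * G.effRes u w = 2 * (Fintype.card V - 1) := by
  have hne : Nonempty V := hG.nonempty
  have hn : (0 : ℝ) < Fintype.card V := by exact_mod_cast Fintype.card_pos
  obtain ⟨M, hM⟩ := hG.exists_isGreen
  have h1 : ∑ u, ∑ w, (G.mult u w : ℝ) * (M u u - M u w) = Fintype.card V - 1 := by
    have : ∀ u, ∑ w, (G.mult u w : ℝ) * (M u u - M u w) = 1 - 1 / (Fintype.card V : ℝ) := by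
      intro u
      have := hM.lap_eq u u
      simpa [lap] using this
    rw [Finset.sum_congr rfl fun u _ => this u]
    simp only [Finset.sum_const, Finset.card_univ, nsmul_eq_mul]
    field_simp
  have h2 : ∑ u, ∑ w, (G.mult u w : ℝ) * (M w w - M u w) = Fintype.card V - 1 := by
    rw [← h1, Finset.sum_comm]
    refine Finset.sum_congr rfl fun u _ => Finset.sum_congr rfl fun w _ => ?_
    rw [G.symm w u, hM.symm w u]
  have h3 : ∑ u, ∑ w, (G.mult u w : ℝ) * G.effRes u w =
      ∑ u, ∑ w, (G.mult u w : ℝ) * (M u u - M u w) +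
      ∑ u, ∑ w, (G.mult u w : ℝ) * (M w w - M u w) := by
    simp only [← Finset.sum_add_distrib]
    refine Finset.sum_congr rfl fun u _ => Finset.sum_congr rfl fun w _ => ?_
    rw [hM.effRes_eq]
    ring
  rw [h3, h1, h2]
  ring

end Electrical

/-! ### Deletion of edges -/

section Deletion

variable {V : Type*} [DecidableEq V]

/-- The graph obtained by deleting one edge between `a` and `b` (if there is one). -/
def deleteEdge (G : Multigraph V) (a b : V) : Multigraph V where
  mult x y := G.mult x y - if (x = a ∧ y = b) ∨ (x = b ∧ y = a) then 1 else 0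
  symm x y := by
    rw [G.symm x y]
    congr 1
    exact if_congr (by tauto) rfl rfl
  loopless x := by simp [G.loopless x]

theorem deleteEdge_mult {G : Multigraph V} {a b : V} (hab : 0 < G.mult a b) (x y : V) :
    ((G.deleteEdge a b).mult x y : ℝ) = (G.mult x y : ℝ) -
      ((if x = a then if y = b then 1 else 0 else 0) +
        (if x = b then if y = a then 1 else 0 else 0)) := by
  have hne : a ≠ b := by
    rintro rfl
    simp [G.loopless] at hab
  have hba : 0 < G.mult b a := by rwa [G.symm]
  have hle : (if (x = a ∧ y = b) ∨ (x = b ∧ y = a) then 1 else 0) ≤ G.mult x y := by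
    split_ifs with h
    · rcases h with ⟨rfl, rfl⟩ | ⟨rfl, rfl⟩ <;> assumption
    · exact Nat.zero_le _
  simp only [deleteEdge]
  rw [Nat.cast_sub hle]
  congr 1
  by_cases h1 : x = a
  · by_cases h2 : y = b <;> simp [h1, h2, hne]
  · by_cases h2 : x = b <;> by_cases h3 : y = a <;> simp [h1, h2, h3, hne.symm]

variable [Fintype V]

theorem deleteEdge_lap {G : Multigraph V} {a b : V} (hab : 0 < G.mult a b) (f : V → ℝ) (u : V) :
    (G.deleteEdge a b).lap f u = G.lap f u -
      ((if u = a then 1 else 0) - (if u = b then 1 else 0)) * (f a - f b) := by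
  have hne : a ≠ b := by
    rintro rfl
    simp [G.loopless] at hab
  simp only [lap, deleteEdge_mult hab, sub_mul, Finset.sum_sub_distrib, add_mul,
    Finset.sum_add_distrib]
  congr 1
  by_cases h1 : u = a
  · simp [h1, hne]
  · by_cases h2 : u = b <;> simp [h1, h2, hne.symm]

theorem deleteEdge_degSum {G : Multigraph V} {a b : V} (hab : 0 < G.mult a b) :
    (G.deleteEdge a b).degSum + 2 = G.degSum := by
  have h : ((G.deleteEdge a b).degSum : ℝ) = (G.degSum : ℝ) - 2 := by
    simp only [degSum, Nat.cast_sum, deleteEdge_mult hab, Finset.sum_sub_distrib,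
      Finset.sum_add_distrib]
    simp
    norm_num
  have h2 : (((G.deleteEdge a b).degSum + 2 : ℕ) : ℝ) = (G.degSum : ℝ) := by
    push_cast
    linarith
  exact_mod_cast h2

/-- Rank-one update: if the edge `ab` has effective resistance `Q a - Q b < 1`, deleting it
changes the potential `P` of a unit current flow by a multiple of `Q`. -/
theorem IsUnitPotential.deleteEdge {G : Multigraph V} {a b x y : V} (hab : 0 < G.mult a b)
    {P Q : V → ℝ} (hP : G.IsUnitPotential x y P) (hQ : G.IsUnitPotential a b Q)
    (hR : Q a - Q b < 1) :
    (G.deleteEdge a b).IsUnitPotential x y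
      (fun u => P u + (P a - P b) / (1 - (Q a - Q b)) * Q u) := by
  have hne : 1 - (Q a - Q b) ≠ 0 := by linarith
  rw [isUnitPotential_iff] at hP hQ ⊢
  intro u
  have h1 : G.lap (fun u => P u + (P a - P b) / (1 - (Q a - Q b)) * Q u) u =
      G.lap P u + (P a - P b) / (1 - (Q a - Q b)) * G.lap Q u := by
    simp only [lap, Finset.mul_sum, ← Finset.sum_add_distrib]
    exact Finset.sum_congr rfl fun w _ => by ring
  rw [deleteEdge_lap hab, h1, hP, hQ]
  field_simp
  ring

theorem Connected.deleteEdge {G : Multigraph V} (hG : G.Connected) {a b : V}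
    (hab : 0 < G.mult a b) (hR : G.effRes a b < 1) : (G.deleteEdge a b).Connected := by
  have hne : Nonempty V := ⟨a⟩
  refine connected_of_isUnitPotential fun x y => ?_
  obtain ⟨P, hP⟩ := hG.exists_isUnitPotential x y
  obtain ⟨Q, hQ⟩ := hG.exists_isUnitPotential a b
  rw [effRes_eq hQ] at hR
  exact ⟨_, hP.deleteEdge hab hQ hR⟩

theorem Connected.deleteEdge_effRes {G : Multigraph V} (hG : G.Connected) {a b : V}
    (hab : 0 < G.mult a b) (hR : G.effRes a b < 1) {x y : V} {P : V → ℝ}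
    (hP : G.IsUnitPotential x y P) :
    (G.deleteEdge a b).effRes x y =
      G.effRes x y + (P a - P b) ^ 2 / (1 - G.effRes a b) := by
  obtain ⟨Q, hQ⟩ := hG.exists_isUnitPotential a b
  have hRQ := effRes_eq hQ
  rw [hRQ] at hR
  -- reciprocity
  have h1 : Q x - Q y = P a - P b := by
    rw [← hP.energyForm Q, ← hQ.energyForm P, energyForm_comm]
  rw [effRes_eq (hP.deleteEdge hab hQ hR), effRes_eq hP, hRQ, ← sub_eq_zero]
  have h2 : Q x = Q y + (P a - P b) := by linarith
  rw [h2]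
  ring

/-- Some edge can be deleted so that the total resistance grows at most by the factor `1 + 1 / β`,
where `β = e - n + 1` is the cyclomatic number. Deleting `uw` adds `i² / (1 - R_uw)` to the
resistance between `x` and `y`, where `i` is the current in `uw`; by Foster's theorem the weights
`1 - R_uw` sum to `β` over the edges, and the numbers `i²` sum to the resistance itself. -/
theorem Connected.exists_deleteEdge {G : Multigraph V} (hG : G.Connected)
    (hβ : 0 < (G.degSum : ℝ) / 2 - Fintype.card V + 1) :
    ∃ H : Multigraph V, H.Connected ∧ H.degSum + 2 = G.degSum ∧
      H.totalRes * ((G.degSum : ℝ) / 2 - Fintype.card V + 1) ≤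
        G.totalRes * ((G.degSum : ℝ) / 2 - Fintype.card V + 2) := by
  set β : ℝ := (G.degSum : ℝ) / 2 - Fintype.card V + 1 with hβdef
  choose P hP using hG.exists_isUnitPotential
  set J : V → V → ℝ := fun u w => ∑ x, ∑ y, (P x y u - P x y w) ^ 2 with hJ
  have hJ0 : ∀ u w, 0 ≤ J u w := fun u w => by positivity
  have hT : ∀ u w, 0 < G.mult u w → G.effRes u w < 1 →
      (G.deleteEdge u w).totalRes = G.totalRes + J u w / (1 - G.effRes u w) := by
    intro u w h0 h1
    simp only [totalRes, hG.deleteEdge_effRes h0 h1 (hP _ _), hJ, Finset.sum_add_distrib,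
      Finset.sum_div]
  have hsumJ : ∑ u, ∑ w, (G.mult u w : ℝ) * J u w = 2 * G.totalRes := by
    have h1 : ∀ x y, ∑ u, ∑ w, (G.mult u w : ℝ) * (P x y u - P x y w) ^ 2 =
        2 * G.effRes x y := by
      intro x y
      rw [(hP x y).effRes_eq_energy, energy]
      ring
    simp only [totalRes, Finset.mul_sum, ← h1, hJ]
    have h2 : ∀ F : V × V → V × V → ℝ, ∑ u, ∑ w, ∑ x, ∑ y, F (u, w) (x, y) =
        ∑ x, ∑ y, ∑ u, ∑ w, F (u, w) (x, y) := by
      intro F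
      calc _ = ∑ p : V × V, ∑ q : V × V, F p q := by simp only [Fintype.sum_prod_type]
        _ = ∑ q : V × V, ∑ p : V × V, F p q := Finset.sum_comm
        _ = _ := by simp only [Fintype.sum_prod_type]
    exact h2 fun p q => (G.mult p.1 p.2 : ℝ) * (P q.1 q.2 p.1 - P q.1 q.2 p.2) ^ 2
  have hsumR : ∑ u, ∑ w, (G.mult u w : ℝ) * (1 - G.effRes u w) = 2 * β := by
    simp only [mul_sub, Finset.sum_sub_distrib, hG.foster, mul_one]
    rw [hβdef, degSum]
    push_cast
    ring
  by_contra hcon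
  push Not at hcon
  have hstrict : ∀ u w, 0 < G.mult u w → G.effRes u w < 1 →
      G.totalRes * (1 - G.effRes u w) < β * J u w := by
    intro u w h0 h1
    have h2 := hcon _ (hG.deleteEdge h0 h1) (deleteEdge_degSum h0)
    rw [hT u w h0 h1] at h2
    have h3 : 0 < 1 - G.effRes u w := by linarith
    have h4 : G.totalRes < J u w / (1 - G.effRes u w) * β := by
      have : (G.degSum : ℝ) / 2 - Fintype.card V + 2 = β + 1 := by rw [hβdef]; ring
      rw [this] at h2
      linarith
    rw [div_mul_eq_mul_div, lt_div_iff₀ h3] at h4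
    linarith
  have hweak : ∀ u w, (G.mult u w : ℝ) * (G.totalRes * (1 - G.effRes u w)) ≤
      (G.mult u w : ℝ) * (β * J u w) := by
    intro u w
    rcases Nat.eq_zero_or_pos (G.mult u w) with h0 | h0
    · simp [h0]
    · refine mul_le_mul_of_nonneg_left ?_ (Nat.cast_nonneg _)
      rcases lt_or_ge (G.effRes u w) 1 with h1 | h1
      · exact (hstrict u w h0 h1).le
      · have h2 : G.totalRes * (1 - G.effRes u w) ≤ 0 :=
          mul_nonpos_of_nonneg_of_nonpos hG.totalRes_nonneg (by linarith)
        have := mul_nonneg hβ.le (hJ0 u w)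
        linarith
  obtain ⟨u, w, h0, h1⟩ : ∃ u w, 0 < G.mult u w ∧ G.effRes u w < 1 := by
    by_contra hno
    push Not at hno
    have : ∑ u, ∑ w, (G.mult u w : ℝ) * (1 - G.effRes u w) ≤ 0 := by
      refine Finset.sum_nonpos fun u _ => Finset.sum_nonpos fun w _ => ?_
      rcases Nat.eq_zero_or_pos (G.mult u w) with h0 | h0
      · simp [h0]
      · exact mul_nonpos_of_nonneg_of_nonpos (Nat.cast_nonneg _) (by linarith [hno u w h0])
    linarith
  have hlt : ∑ u, ∑ w, (G.mult u w : ℝ) * (G.totalRes * (1 - G.effRes u w)) <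
      ∑ u, ∑ w, (G.mult u w : ℝ) * (β * J u w) := by
    refine Finset.sum_lt_sum (fun u _ => Finset.sum_le_sum fun w _ => hweak u w)
      ⟨u, Finset.mem_univ u, Finset.sum_lt_sum (fun w _ => hweak u w)
        ⟨w, Finset.mem_univ w, ?_⟩⟩
    exact mul_lt_mul_of_pos_left (hstrict u w h0 h1) (by exact_mod_cast h0)
  have h2 : ∑ u, ∑ w, (G.mult u w : ℝ) * (G.totalRes * (1 - G.effRes u w)) =
      G.totalRes * (2 * β) := by
    rw [← hsumR]
    simp only [Finset.mul_sum]
    exact Finset.sum_congr rfl fun u _ => Finset.sum_congr rfl fun w _ => by ring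
  have h3 : ∑ u, ∑ w, (G.mult u w : ℝ) * (β * J u w) = β * (2 * G.totalRes) := by
    rw [← hsumJ]
    simp only [Finset.mul_sum]
    exact Finset.sum_congr rfl fun u _ => Finset.sum_congr rfl fun w _ => by ring
  rw [h2, h3] at hlt
  linarith

/-- Deleting `k` suitable edges, one after the other: the product of the total resistance with
`e - n + 2` does not grow. -/
theorem Connected.exists_deleteEdges {G : Multigraph V} (hG : G.Connected) (k : ℕ)
    (hk : (k : ℝ) ≤ (G.degSum : ℝ) / 2 - Fintype.card V + 1) :
    ∃ H : Multigraph V, H.Connected ∧ H.degSum + 2 * k = G.degSum ∧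
      H.totalRes * ((H.degSum : ℝ) / 2 - Fintype.card V + 2) ≤
        G.totalRes * ((G.degSum : ℝ) / 2 - Fintype.card V + 2) := by
  induction k with
  | zero => exact ⟨G, hG, rfl, le_rfl⟩
  | succ k ih =>
    push_cast at hk
    obtain ⟨H, hH, hd, hT⟩ := ih (by linarith)
    have hd' : (H.degSum : ℝ) + 2 * k = G.degSum := by exact_mod_cast hd
    obtain ⟨K, hK, hd2, hT2⟩ := hH.exists_deleteEdge (by linarith)
    have hd2' : (K.degSum : ℝ) + 2 = H.degSum := by exact_mod_cast hd2
    refine ⟨K, hK, by omega, le_trans (le_of_eq ?_) (hT2.trans hT)⟩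
    congr 1
    linarith

end Deletion

/-! ### Deletion of leaves -/

section Core

variable {V : Type*} [Fintype V]

theorem card_leaf_add {G : Multigraph V} :
    Fintype.card {x : V // G.degree x ≠ 1} + G.numLeaves = Fintype.card V := by
  rw [numLeaves, Fintype.card_subtype, add_comm]
  exact Finset.card_filter_add_card_filter_not _

variable [DecidableEq V]

/-- The graph obtained by deleting all leaves. -/
def core (G : Multigraph V) : Multigraph {x : V // G.degree x ≠ 1} where
  mult x y := G.mult x y
  symm x y := G.symm x y
  loopless x := G.loopless x

/-- A leaf has a unique neighbour. -/
theorem exists_mult_eq_of_degree_eq_one {G : Multigraph V} {x : V} (hx : G.degree x = 1) :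
    ∃ v, ∀ y, G.mult x y = if y = v then 1 else 0 := by
  unfold degree at hx
  obtain ⟨v, hv⟩ : ∃ v, G.mult x v ≠ 0 := by
    by_contra h
    push Not at h
    simp [h] at hx
  refine ⟨v, fun y => ?_⟩
  have h1 := Finset.add_sum_erase Finset.univ (fun y => G.mult x y) (Finset.mem_univ v)
  split_ifs with hy
  · subst hy
    omega
  · have h2 : G.mult x y ≤ ∑ z ∈ Finset.univ.erase v, G.mult x z :=
      Finset.single_le_sum (f := fun z => G.mult x z) (fun _ _ => Nat.zero_le _)
        (Finset.mem_erase.2 ⟨hy, Finset.mem_univ y⟩)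
    omega

theorem lap_of_leaf {G : Multigraph V} {x v : V} (h : ∀ y, G.mult x y = if y = v then 1 else 0)
    (f : V → ℝ) : G.lap f x = f x - f v := by
  simp [lap, h]

/-- In a connected graph with more than two vertices no two leaves are adjacent. -/
theorem Connected.degree_ne_one_of_leaf {G : Multigraph V} (hG : G.Connected)
    (hV : 2 < Fintype.card V) {x v : V} (h : ∀ y, G.mult x y = if y = v then 1 else 0) :
    G.degree v ≠ 1 := by
  intro hv
  obtain ⟨x', hx'⟩ := exists_mult_eq_of_degree_eq_one hv
  have hxx : x = x' := by
    have h1 := h v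
    rw [G.symm, hx'] at h1
    by_contra hne
    simp [hne] at h1
  subst hxx
  -- the two leaves would form a component
  have h0 : G.energy (fun z => if z = x ∨ z = v then 1 else 0) = 0 := by
    unfold energy
    rw [div_eq_zero_iff]
    left
    refine Finset.sum_eq_zero fun a _ => Finset.sum_eq_zero fun b _ => ?_
    by_cases ha : a = x ∨ a = v
    · by_cases hb : b = x ∨ b = v
      · simp [ha, hb]
      · rw [not_or] at hb
        rcases ha with rfl | rfl
        · simp [h, hb.2]
        · simp [hx', hb.1]
    · by_cases hb : b = x ∨ b = v
      · rw [not_or] at ha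
        rcases hb with rfl | rfl
        · simp [G.symm a, h, ha.2]
        · simp [G.symm a, hx', ha.1]
      · simp [ha, hb]
  obtain ⟨z, hz⟩ : ∃ z, z ∉ ({x, v} : Finset V) := by
    by_contra hall
    push Not at hall
    have h1 : Finset.univ ⊆ ({x, v} : Finset V) := fun z _ => hall z
    have h2 := Finset.card_le_card h1
    have h3 : ({x, v} : Finset V).card ≤ 2 := Finset.card_le_two
    rw [Finset.card_univ] at h2
    omega
  simp only [Finset.mem_insert, Finset.mem_singleton] at hz
  have := hG.eq_of_energy_eq_zero h0 x z
  simp [hz] at this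

/-- The current into a leaf vanishes unless the leaf is a terminal, so that potentials of the graph
restrict to potentials of the core. -/
theorem IsUnitPotential.core {G : Multigraph V} {x y : {x : V // G.degree x ≠ 1}} {P : V → ℝ}
    (hP : G.IsUnitPotential x y P) : G.core.IsUnitPotential x y (fun u => P u) := by
  rw [isUnitPotential_iff] at hP ⊢
  intro u
  have h1 := hP u
  simp only [← Subtype.ext_iff] at h1
  rw [← h1, lap, lap, ← Fintype.sum_subtype_add_sum_subtype (fun w => G.degree w ≠ 1)]
  have h2 : ∑ w : {w : V // ¬ G.degree w ≠ 1}, (G.mult u w : ℝ) * (P u - P w) = 0 := by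
    refine Finset.sum_eq_zero fun w _ => ?_
    have hw : G.degree (w : V) = 1 := not_not.1 w.2
    obtain ⟨v, hv⟩ := exists_mult_eq_of_degree_eq_one hw
    have h3 := hP w
    have hwx : (w : V) ≠ x := fun h => x.2 (h ▸ hw)
    have hwy : (w : V) ≠ y := fun h => y.2 (h ▸ hw)
    rw [lap_of_leaf hv, if_neg hwx, if_neg hwy] at h3
    rw [G.symm, hv]
    split_ifs with huv
    · rw [huv, Nat.cast_one]
      linarith
    · simp
  rw [h2, add_zero]
  rfl

theorem Connected.core_effRes {G : Multigraph V} (hG : G.Connected)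
    (x y : {x : V // G.degree x ≠ 1}) : G.core.effRes x y = G.effRes x y := by
  obtain ⟨P, hP⟩ := hG.exists_isUnitPotential (x : V) y
  rw [effRes_eq hP, effRes_eq hP.core]

theorem Connected.core_nonempty {G : Multigraph V} (hG : G.Connected)
    (hV : 2 < Fintype.card V) : Nonempty {x : V // G.degree x ≠ 1} := by
  obtain ⟨x⟩ := hG.nonempty
  by_cases hx : G.degree x = 1
  · obtain ⟨v, hv⟩ := exists_mult_eq_of_degree_eq_one hx
    exact ⟨v, hG.degree_ne_one_of_leaf hV hv⟩
  · exact ⟨x, hx⟩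

theorem Connected.core {G : Multigraph V} (hG : G.Connected) (hV : 2 < Fintype.card V) :
    G.core.Connected := by
  have hne := hG.core_nonempty hV
  refine connected_of_isUnitPotential fun x y => ?_
  obtain ⟨P, hP⟩ := hG.exists_isUnitPotential (x : V) y
  exact ⟨_, hP.core⟩

/-- The resistance from a leaf `x` with neighbour `v`. -/
theorem Connected.effRes_of_leaf {G : Multigraph V} (hG : G.Connected) {x v y : V}
    (h : ∀ y, G.mult x y = if y = v then 1 else 0) (hxy : x ≠ y) :
    G.effRes x y = 1 + G.effRes v y := by
  obtain ⟨P, hP⟩ := hG.exists_isUnitPotential v y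
  have hxv : x ≠ v := by
    rintro rfl
    have := h x
    simp [G.loopless] at this
  have hPx : P x = P v := by
    have h1 := isUnitPotential_iff.1 hP x
    rw [lap_of_leaf h, if_neg hxv, if_neg hxy] at h1
    linarith
  have hQ : G.IsUnitPotential x y (fun u => P u + if u = x then 1 else 0) := by
    rw [isUnitPotential_iff] at hP ⊢
    intro u
    have h1 : G.lap (fun u => P u + if u = x then 1 else 0) u =
        G.lap P u + G.lap (fun u => if u = x then 1 else 0) u := by
      simp only [lap, ← Finset.sum_add_distrib]
      exact Finset.sum_congr rfl fun w _ => by ring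
    have h2 : G.lap (fun u => if u = x then 1 else 0) u =
        (if u = x then 1 else 0) - (if u = v then 1 else 0) := by
      by_cases hu : u = x
      · subst hu
        rw [lap_of_leaf h]
        simp [hxv, hxv.symm]
      · simp [lap, hu, G.symm u x, h]
    rw [h1, h2, hP]
    ring
  rw [effRes_eq hQ, effRes_eq hP, hPx]
  simp [hxy.symm]
  ring

theorem Connected.core_degSum {G : Multigraph V} (hG : G.Connected) (hV : 2 < Fintype.card V) :
    G.core.degSum + 2 * G.numLeaves = G.degSum := by
  have hl : Fintype.card {x : V // ¬ G.degree x ≠ 1} = G.numLeaves := by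
    rw [numLeaves, Fintype.card_subtype]
    simp
  have h1 : ∀ x : {x : V // ¬ G.degree x ≠ 1},
      ∑ y : {x : V // G.degree x ≠ 1}, G.mult x y = 1 := by
    intro x
    obtain ⟨v, hv⟩ := exists_mult_eq_of_degree_eq_one (not_not.1 x.2)
    have hvd := hG.degree_ne_one_of_leaf hV hv
    rw [Finset.sum_eq_single (⟨v, hvd⟩ : {x : V // G.degree x ≠ 1})]
    · simp [hv]
    · intro y _ hy
      rw [hv, if_neg]
      rintro rfl
      exact hy rfl
    · simp
  have h2 : ∑ x : {x : V // ¬ G.degree x ≠ 1}, ∑ y, G.mult x y = G.numLeaves := by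
    rw [← hl, Fintype.card_eq_sum_ones]
    exact Finset.sum_congr rfl fun x _ => not_not.1 x.2
  have h3 : ∑ x : {x : V // G.degree x ≠ 1}, ∑ y : {x : V // ¬ G.degree x ≠ 1}, G.mult x y =
      G.numLeaves := by
    rw [Finset.sum_comm, ← hl, Fintype.card_eq_sum_ones]
    refine Finset.sum_congr rfl fun x _ => ?_
    exact (Finset.sum_congr rfl fun y _ => G.symm _ _).trans (h1 x)
  unfold degSum
  rw [← Fintype.sum_subtype_add_sum_subtype (fun w => G.degree w ≠ 1) (fun x => ∑ y, G.mult x y),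
    h2]
  have h4 : ∑ x : {x : V // G.degree x ≠ 1}, ∑ y, G.mult x y =
      ∑ x : {x : V // G.degree x ≠ 1}, ((∑ y : {x : V // G.degree x ≠ 1}, G.mult x y) +
        ∑ y : {x : V // ¬ G.degree x ≠ 1}, G.mult x y) :=
    Finset.sum_congr rfl fun x _ => (Fintype.sum_subtype_add_sum_subtype
      (fun w => G.degree w ≠ 1) (fun y => G.mult x y)).symm
  rw [h4, Finset.sum_add_distrib, h3]
  simp only [Multigraph.core]
  ring

/-- Leaves are expensive: a leaf `x` at `v` has resistance `1 + R_vy` to every `y`, and the average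
of `R_vy` over the core is at least half of the average resistance of the core, whatever `v` is. -/
theorem Connected.totalRes_ge {G : Multigraph V} (hG : G.Connected) (hV : 2 < Fintype.card V) :
    G.core.totalRes * (Fintype.card V / Fintype.card {x : V // G.degree x ≠ 1}) +
      2 * G.numLeaves * (Fintype.card V - 1) ≤ G.totalRes := by
  have hC := hG.core hV
  have hm : (0 : ℝ) < Fintype.card {x : V // G.degree x ≠ 1} := by
    have hne := hG.core_nonempty hV
    exact_mod_cast Fintype.card_pos
  have hn : (Fintype.card V : ℝ) = Fintype.card {x : V // G.degree x ≠ 1} + G.numLeaves := by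
    exact_mod_cast (card_leaf_add (G := G)).symm
  have hl : Fintype.card {x : V // ¬ G.degree x ≠ 1} = G.numLeaves := by
    rw [numLeaves, Fintype.card_subtype]
    simp
  obtain ⟨M, hM⟩ := hC.exists_isGreen
  set m : ℝ := ((Fintype.card {x : V // G.degree x ≠ 1} : ℕ) : ℝ) with hmdef
  set T := G.core.totalRes with hTdef
  -- the mean resistance from a vertex of the core
  have h1 : ∀ v : {x : V // G.degree x ≠ 1}, T / (2 * m) ≤
      ∑ y : {x : V // G.degree x ≠ 1}, G.effRes v y := by
    intro v
    simp only [← hG.core_effRes]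
    rw [hM.sum_effRes, hTdef, hM.totalRes_eq, ← hmdef]
    have := mul_nonneg hm.le (hM.diag_nonneg v)
    have h2 : 2 * m * ∑ x, M x x / (2 * m) = ∑ x, M x x := by
      rw [← Finset.sum_div]
      field_simp
    rw [mul_div_assoc, Finset.sum_div, h2]
    linarith
  have h2 : ∀ x : {x : V // ¬ G.degree x ≠ 1}, m + T / (2 * m) ≤
      ∑ y : {x : V // G.degree x ≠ 1}, G.effRes x y := by
    intro x
    obtain ⟨v, hv⟩ := exists_mult_eq_of_degree_eq_one (not_not.1 x.2)
    have hvd := hG.degree_ne_one_of_leaf hV hv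
    have h3 : ∀ y : {x : V // G.degree x ≠ 1}, G.effRes x y = 1 + G.effRes v y := fun y =>
      hG.effRes_of_leaf hv (fun h => y.2 (h ▸ not_not.1 x.2))
    simp only [h3, Finset.sum_add_distrib]
    have := h1 ⟨v, hvd⟩
    simp only at this
    simp only [Finset.sum_const, Finset.card_univ, nsmul_eq_mul, mul_one, ← hmdef]
    linarith
  have h3 : ∀ x : {x : V // ¬ G.degree x ≠ 1}, 2 * ((G.numLeaves : ℝ) - 1) ≤
      ∑ y : {x : V // ¬ G.degree x ≠ 1}, G.effRes x y := by
    intro x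
    obtain ⟨v, hv⟩ := exists_mult_eq_of_degree_eq_one (not_not.1 x.2)
    have hvd := hG.degree_ne_one_of_leaf hV hv
    have h4 : ∀ y : {x : V // ¬ G.degree x ≠ 1}, (2 - if y = x then 2 else 0) ≤
        G.effRes x y := by
      intro y
      split_ifs with hyx
      · simpa using hG.effRes_nonneg _ _
      · obtain ⟨w, hw⟩ := exists_mult_eq_of_degree_eq_one (not_not.1 y.2)
        rw [hG.effRes_of_leaf hv (fun h => hyx (Subtype.ext h.symm)), hG.effRes_comm v,
          hG.effRes_of_leaf hw (fun h : (y : V) = v => hvd (h ▸ not_not.1 y.2))]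
        have := hG.effRes_nonneg w v
        linarith
    refine le_trans (le_of_eq ?_) (Finset.sum_le_sum fun y _ => h4 y)
    rw [Finset.sum_sub_distrib]
    simp only [Finset.sum_const, Finset.card_univ, hl, nsmul_eq_mul, Finset.sum_ite_eq',
      Finset.mem_univ, if_true]
    ring
  have e1 : G.totalRes =
      (∑ x : {x : V // G.degree x ≠ 1}, ∑ y : {x : V // G.degree x ≠ 1}, G.effRes x y) +
      (∑ x : {x : V // G.degree x ≠ 1}, ∑ y : {x : V // ¬ G.degree x ≠ 1}, G.effRes x y) +
      ((∑ x : {x : V // ¬ G.degree x ≠ 1}, ∑ y : {x : V // G.degree x ≠ 1}, G.effRes x y) +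
      (∑ x : {x : V // ¬ G.degree x ≠ 1}, ∑ y : {x : V // ¬ G.degree x ≠ 1},
        G.effRes x y)) := by
    unfold totalRes
    rw [← Fintype.sum_subtype_add_sum_subtype (fun w => G.degree w ≠ 1), ← Finset.sum_add_distrib,
      ← Finset.sum_add_distrib]
    congr 1 <;> refine Finset.sum_congr rfl fun x _ => ?_ <;>
      exact (Fintype.sum_subtype_add_sum_subtype (fun w => G.degree w ≠ 1) _).symm
  have e2 : (∑ x : {x : V // G.degree x ≠ 1}, ∑ y : {x : V // ¬ G.degree x ≠ 1},
      G.effRes x y) = ∑ x : {x : V // ¬ G.degree x ≠ 1}, ∑ y : {x : V // G.degree x ≠ 1},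
      G.effRes x y := by
    rw [Finset.sum_comm]
    exact Finset.sum_congr rfl fun x _ => Finset.sum_congr rfl fun y _ => hG.effRes_comm _ _
  have e3 : (∑ x : {x : V // G.degree x ≠ 1}, ∑ y : {x : V // G.degree x ≠ 1},
      G.effRes x y) = T := by
    simp only [hTdef, totalRes, hG.core_effRes]
  have i1 : (G.numLeaves : ℝ) * (m + T / (2 * m)) ≤
      ∑ x : {x : V // ¬ G.degree x ≠ 1}, ∑ y : {x : V // G.degree x ≠ 1}, G.effRes x y := by
    refine le_trans (le_of_eq ?_) (Finset.sum_le_sum fun x _ => h2 x)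
    simp only [Finset.sum_const, Finset.card_univ, hl, nsmul_eq_mul]
  have i2 : (G.numLeaves : ℝ) * (2 * ((G.numLeaves : ℝ) - 1)) ≤
      ∑ x : {x : V // ¬ G.degree x ≠ 1}, ∑ y : {x : V // ¬ G.degree x ≠ 1},
        G.effRes x y := by
    refine le_trans (le_of_eq ?_) (Finset.sum_le_sum fun x _ => h3 x)
    simp only [Finset.sum_const, Finset.card_univ, hl, nsmul_eq_mul]
  rw [e1, e2, e3, hn]
  have : T * ((m + G.numLeaves) / m) = T + 2 * (G.numLeaves * (T / (2 * m))) := by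
    field_simp
  rw [this]
  linarith

end Core

/-! ### Copies of a graph joined through a hub -/

section Hub

variable {V : Type*}

/-- The graph consisting of a hub `none`, `k` disjoint copies of `H`, and `l` leaves at the hub;
in every copy the vertex `x` is joined to the hub by `c x` edges. -/
def hubGraph (H : Multigraph V) (c : V → ℕ) (k l : ℕ) :
    Multigraph (Option ((Fin k × V) ⊕ Fin l)) where
  mult
    | none, none => 0
    | none, some (Sum.inl p) => c p.2
    | none, some (Sum.inr _) => 1
    | some (Sum.inl p), none => c p.2
    | some (Sum.inr _), none => 1
    | some (Sum.inl p), some (Sum.inl q) => if p.1 = q.1 then H.mult p.2 q.2 else 0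
    | some (Sum.inl _), some (Sum.inr _) => 0
    | some (Sum.inr _), some _ => 0
  symm := by
    rintro (_ | p | i) (_ | q | j) <;> simp only
    rw [H.symm]
    exact if_congr eq_comm rfl rfl
  loopless := by
    rintro (_ | p | i) <;> simp [H.loopless]

variable [Fintype V]

theorem hubGraph_degSum (H : Multigraph V) (c : V → ℕ) (k l : ℕ) :
    (H.hubGraph c k l).degSum = k * (H.degSum + 2 * ∑ x, c x) + 2 * l := by
  simp only [degSum, hubGraph, Fintype.sum_option, Fintype.sum_sum_type, Fintype.sum_prod_type]
  simp [Finset.sum_add_distrib]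
  ring

theorem hubGraph_energy (H : Multigraph V) (c : V → ℕ) (k l : ℕ)
    (f : Option ((Fin k × V) ⊕ Fin l) → ℝ) :
    (H.hubGraph c k l).energy f =
      ∑ i : Fin k, (H.energy (fun x => f (some (Sum.inl (i, x))) - f none) +
        ∑ x, (c x : ℝ) * (f (some (Sum.inl (i, x))) - f none) ^ 2) +
      ∑ j : Fin l, (f (some (Sum.inr j)) - f none) ^ 2 := by
  have h1 : ∀ (i : Fin k) (x : V), ∑ j : Fin k, ∑ y : V,
      ((if i = j then H.mult x y else 0 : ℕ) : ℝ) *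
        (f (some (Sum.inl (i, x))) - f (some (Sum.inl (j, y)))) ^ 2 =
      ∑ y : V, (H.mult x y : ℝ) *
        (f (some (Sum.inl (i, x))) - f (some (Sum.inl (i, y)))) ^ 2 := by
    intro i x
    rw [Finset.sum_eq_single i]
    · simp
    · intro j _ hj
      simp [hj.symm]
    · simp
  simp only [energy, hubGraph, Fintype.sum_option, Fintype.sum_sum_type, Fintype.sum_prod_type, h1,
    sub_sub_sub_cancel_right, Finset.sum_add_distrib, ← Finset.sum_div]
  simp only [Nat.cast_zero, zero_mul, Finset.sum_const_zero, Nat.cast_one, one_mul, add_zero,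
    zero_add]
  have h2 : ∀ a b : ℝ, (a - b) ^ 2 = (b - a) ^ 2 := fun a b => by ring
  simp only [fun a : (Fin k × V) ⊕ Fin l => h2 (f none) (f (some a))]
  ring

/-- `D` bounds the effective resistances between the vertices of `H` and a hub to which each vertex
`x` is joined by `c x` edges: the inequality is Dirichlet's principle, with the potential of the hub
normalised to zero. -/
structure IsHubBound (H : Multigraph V) (c : V → ℕ) (D : V → ℝ) : Prop where
  nonneg : ∀ x, 0 ≤ D x
  sq_le : ∀ x (f : V → ℝ), f x ^ 2 ≤ D x * (H.energy f + ∑ y, (c y : ℝ) * f y ^ 2)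

/-- The energy that `f` spends on the copy of `H`, or the leaf, containing a given vertex. -/
noncomputable def branchEnergy (H : Multigraph V) (c : V → ℕ) {k l : ℕ}
    (f : Option ((Fin k × V) ⊕ Fin l) → ℝ) : Fin k ⊕ Fin l → ℝ
  | Sum.inl i => H.energy (fun x => f (some (Sum.inl (i, x))) - f none) +
        ∑ x, (c x : ℝ) * (f (some (Sum.inl (i, x))) - f none) ^ 2
  | Sum.inr j => (f (some (Sum.inr j)) - f none) ^ 2

/-- The branch (copy of `H` or leaf) containing a vertex other than the hub. -/
def branch {k l : ℕ} : (Fin k × V) ⊕ Fin l → Fin k ⊕ Fin l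
  | Sum.inl p => Sum.inl p.1
  | Sum.inr j => Sum.inr j

/-- The bound for the resistance to the hub. -/
def hubDist (D : V → ℝ) {k l : ℕ} : (Fin k × V) ⊕ Fin l → ℝ
  | Sum.inl p => D p.2
  | Sum.inr _ => 1

variable {H : Multigraph V} {c : V → ℕ} {D : V → ℝ} {k l : ℕ}

theorem branchEnergy_nonneg (f : Option ((Fin k × V) ⊕ Fin l) → ℝ) (b : Fin k ⊕ Fin l) :
    0 ≤ H.branchEnergy c f b := by
  rcases b with i | j
  · have := H.energy_nonneg (fun x => f (some (Sum.inl (i, x))) - f none)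
    simp only [branchEnergy]
    positivity
  · simp only [branchEnergy]
    positivity

theorem sum_branchEnergy (f : Option ((Fin k × V) ⊕ Fin l) → ℝ) :
    ∑ b, H.branchEnergy c f b = (H.hubGraph c k l).energy f := by
  rw [hubGraph_energy, Fintype.sum_sum_type]
  rfl

namespace IsHubBound

theorem hubDist_nonneg (hD : H.IsHubBound c D) (w : (Fin k × V) ⊕ Fin l) : 0 ≤ hubDist D w := by
  rcases w with p | j
  · exact hD.nonneg _
  · exact zero_le_one

theorem sq_sub_hub_le (hD : H.IsHubBound c D) (f : Option ((Fin k × V) ⊕ Fin l) → ℝ)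
    (w : (Fin k × V) ⊕ Fin l) :
    (f (some w) - f none) ^ 2 ≤ hubDist D w * H.branchEnergy c f (branch w) := by
  rcases w with p | j
  · exact hD.sq_le p.2 fun x => f (some (Sum.inl (p.1, x))) - f none
  · simp [hubDist, branchEnergy, branch]

theorem connected (hD : H.IsHubBound c D) : (H.hubGraph c k l).Connected := by
  refine connected_of_energy fun f hf => ?_
  have h0 : ∀ w, f w = f none := by
    rintro (_ | w)
    · rfl
    · have h1 := hD.sq_sub_hub_le f w
      have h2 : H.branchEnergy c f (branch w) = 0 := by
        rw [← sum_branchEnergy, Finset.sum_eq_zero_iff_of_nonneg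
          (fun b _ => branchEnergy_nonneg f b)] at hf
        exact hf _ (Finset.mem_univ _)
      rw [h2, mul_zero] at h1
      have h3 := pow_eq_zero_iff two_ne_zero |>.1 (le_antisymm h1 (sq_nonneg _))
      linarith
  intro x y
  rw [h0 x, h0 y]

variable [DecidableEq V]

theorem effRes_hub_le (hD : H.IsHubBound c D) (w : (Fin k × V) ⊕ Fin l) :
    (H.hubGraph c k l).effRes (some w) none ≤ hubDist D w := by
  refine hD.connected.effRes_le (hD.hubDist_nonneg w) fun f => (hD.sq_sub_hub_le f w).trans ?_
  refine mul_le_mul_of_nonneg_left ?_ (hD.hubDist_nonneg w)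
  rw [← sum_branchEnergy]
  exact Finset.single_le_sum (fun b _ => branchEnergy_nonneg f b) (Finset.mem_univ _)

/-- For vertices of different branches, the resistances to the hub add up. For two vertices of the
same branch the factor `2` is lost, which does not matter since there are few such pairs. -/
theorem effRes_le (hD : H.IsHubBound c D) (w z : (Fin k × V) ⊕ Fin l) :
    (H.hubGraph c k l).effRes (some w) (some z) ≤
      (hubDist D w + hubDist D z) * (1 + if branch w = branch z then 1 else 0) := by
  have hw := hD.hubDist_nonneg w
  have hz := hD.hubDist_nonneg z
  refine hD.connected.effRes_le (by split_ifs <;> positivity) fun f => ?_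
  have h1 := hD.sq_sub_hub_le f w
  have h2 := hD.sq_sub_hub_le f z
  have hbw := branchEnergy_nonneg (H := H) (c := c) f (branch w)
  have hbz := branchEnergy_nonneg (H := H) (c := c) f (branch z)
  set a := f (some w) - f none with ha
  set b := f (some z) - f none with hb
  have hab : f (some w) - f (some z) = a - b := by rw [ha, hb]; ring
  rw [hab]
  have hle : ∀ s : Finset (Fin k ⊕ Fin l),
      ∑ b ∈ s, H.branchEnergy c f b ≤ (H.hubGraph c k l).energy f := by
    intro s
    rw [← sum_branchEnergy]
    exact Finset.sum_le_sum_of_subset_of_nonneg (Finset.subset_univ _)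
      (fun b _ _ => branchEnergy_nonneg f b)
  split_ifs with hbr
  · have h3 := hle {branch w}
    rw [Finset.sum_singleton] at h3
    rw [← hbr] at h2
    have h4 : (a - b) ^ 2 ≤ 2 * (a ^ 2 + b ^ 2) := by nlinarith [sq_nonneg (a + b)]
    have h5 := mul_le_mul_of_nonneg_left h3 (add_nonneg hw hz)
    linarith
  · have h3 := hle {branch w, branch z}
    rw [Finset.sum_pair hbr] at h3
    set E := H.branchEnergy c f (branch w)
    set F := H.branchEnergy c f (branch z)
    set p := hubDist D w
    set q := hubDist D z
    have h5 := mul_le_mul_of_nonneg_left h3 (add_nonneg hw hz)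
    -- the cross term: `|ab| ≤ √(pE) √(qF) ≤ (pF + qE) / 2`
    have h6 : |2 * (a * b)| ≤ p * F + q * E := by
      refine abs_le_of_sq_le_sq ?_ (by positivity)
      have := mul_le_mul h1 h2 (sq_nonneg b) (by positivity)
      nlinarith [sq_nonneg (p * F - q * E)]
    have h7 := neg_le_abs (2 * (a * b))
    nlinarith

theorem totalRes_le (hD : H.IsHubBound c D) :
    (H.hubGraph c k l).totalRes ≤
      2 * ((k * Fintype.card V + 1 + l : ℕ) + Fintype.card V + 1) * (k * ∑ x, D x + l) := by
  have hS : ∑ w : (Fin k × V) ⊕ Fin l, hubDist D w = k * ∑ x, D x + l := by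
    simp [Fintype.sum_sum_type, Fintype.sum_prod_type, hubDist]
  have hD0 : 0 ≤ ∑ x, D x := Finset.sum_nonneg fun x _ => hD.nonneg x
  have hcard : Fintype.card ((Fin k × V) ⊕ Fin l) = k * Fintype.card V + l := by simp
  have hcon := hD.connected (k := k) (l := l)
  have h1 : (H.hubGraph c k l).totalRes ≤ 2 * ∑ w : (Fin k × V) ⊕ Fin l, hubDist D w +
      ∑ w : (Fin k × V) ⊕ Fin l, ∑ z : (Fin k × V) ⊕ Fin l,
        (hubDist D w + hubDist D z) * (1 + if branch w = branch z then 1 else 0) := by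
    simp only [totalRes, Fintype.sum_option (α := (Fin k × V) ⊕ Fin l), hcon.effRes_self, zero_add,
      Finset.sum_add_distrib]
    have h2 : ∑ w, (H.hubGraph c k l).effRes (some w) none ≤ ∑ w, hubDist D w :=
      Finset.sum_le_sum fun w _ => hD.effRes_hub_le w
    have h3 : ∑ w, (H.hubGraph c k l).effRes none (some w) ≤ ∑ w, hubDist D w :=
      Finset.sum_le_sum fun w _ => by rw [hcon.effRes_comm]; exact hD.effRes_hub_le w
    have h4 := Finset.sum_le_sum fun (w : (Fin k × V) ⊕ Fin l) (_ : w ∈ Finset.univ) =>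
      Finset.sum_le_sum fun (z : (Fin k × V) ⊕ Fin l) (_ : z ∈ Finset.univ) => hD.effRes_le w z
    linarith
  have h2 : ∑ w : (Fin k × V) ⊕ Fin l, ∑ z : (Fin k × V) ⊕ Fin l,
      (hubDist D w + hubDist D z) = 2 * (k * Fintype.card V + l) * (k * ∑ x, D x + l) := by
    simp only [Finset.sum_add_distrib, Finset.sum_const, Finset.card_univ, hcard, nsmul_eq_mul,
      ← Finset.mul_sum, hS]
    push_cast
    ring
  have h3 : ∑ w : (Fin k × V) ⊕ Fin l, ∑ z : (Fin k × V) ⊕ Fin l,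
      (hubDist D w + hubDist D z) * (if branch w = branch z then 1 else 0) =
      2 * Fintype.card V * (k * ∑ x, D x) + 2 * l := by
    simp only [Fintype.sum_sum_type, Fintype.sum_prod_type, hubDist, branch]
    simp [Finset.sum_add_distrib, ← Finset.mul_sum]
    ring
  simp only [mul_add, mul_one, Finset.sum_add_distrib] at h1 h2 h3
  push_cast
  have hl : (0 : ℝ) ≤ l := Nat.cast_nonneg l
  have hk : (0 : ℝ) ≤ k * ∑ x, D x := mul_nonneg (Nat.cast_nonneg k) hD0
  have hn : (0 : ℝ) ≤ Fintype.card V * l := by positivity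
  nlinarith

end IsHubBound

end Hub

/-! ### Placing the hub at the centre of gravity -/

section Sampling

variable {V : Type*} [Fintype V] [DecidableEq V]

/-- Vertices chosen one after the other so that the vector sum of their positions stays short.
Regarding `M` as the Gram matrix of the positions, which have mean zero, adding a random vertex
increases the squared length of the sum by `tr M / n` on average. -/
theorem IsGreen.exists_sample [Nonempty V] {G : Multigraph V} {M : V → V → ℝ} (hM : G.IsGreen M)
    (t : ℕ) : ∃ c : V → ℕ, ∑ x, c x = t ∧
      ∑ x, ∑ y, (c x : ℝ) * c y * M x y ≤ t * ((∑ x, M x x) / Fintype.card V) := by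
  have hn : (0 : ℝ) < Fintype.card V := by exact_mod_cast Fintype.card_pos
  induction t with
  | zero => exact ⟨fun _ => 0, by simp, by simp⟩
  | succ t ih =>
    obtain ⟨c, hc, hQ⟩ := ih
    have key : ∀ v, ∑ x, ∑ y, ((c x + if x = v then 1 else 0 : ℕ) : ℝ) *
        ((c y + if y = v then 1 else 0 : ℕ) : ℝ) * M x y =
        (∑ x, ∑ y, (c x : ℝ) * c y * M x y) + 2 * (∑ x, (c x : ℝ) * M x v) + M v v := by
      intro v
      push_cast
      simp only [add_mul, mul_add, Finset.sum_add_distrib, ite_mul, mul_ite, one_mul, zero_mul,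
        mul_one, mul_zero, Finset.sum_ite_eq', Finset.mem_univ, if_true, Finset.sum_const_zero,
        Finset.sum_ite_irrel]
      have : ∑ y, (c y : ℝ) * M v y = ∑ y, (c y : ℝ) * M y v :=
        Finset.sum_congr rfl fun y _ => by rw [hM.symm]
      rw [this]
      ring
    have hsum : ∑ v, ((∑ x, ∑ y, (c x : ℝ) * c y * M x y) + 2 * (∑ x, (c x : ℝ) * M x v) +
        M v v) ≤ ∑ _v : V, ((t + 1 : ℕ) : ℝ) * ((∑ x, M x x) / Fintype.card V) := by
      have h0 : ∑ v, ∑ x, (c x : ℝ) * M x v = 0 := by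
        rw [Finset.sum_comm]
        exact Finset.sum_eq_zero fun x _ => by rw [← Finset.mul_sum, hM.sum_eq_zero, mul_zero]
      rw [Finset.sum_add_distrib, Finset.sum_add_distrib, ← Finset.mul_sum, h0]
      simp only [Finset.sum_const, Finset.card_univ, nsmul_eq_mul]
      have h1 := mul_le_mul_of_nonneg_left hQ hn.le
      have h2 : (Fintype.card V : ℝ) * ((∑ x, M x x) / Fintype.card V) = ∑ x, M x x := by
        field_simp
      push_cast
      linarith
    obtain ⟨v, -, hv⟩ := Finset.exists_le_of_sum_le Finset.univ_nonempty hsum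
    refine ⟨fun x => c x + if x = v then 1 else 0, by simp [Finset.sum_add_distrib, hc], ?_⟩
    rw [key]
    exact hv

/-- Joining the hub to `t` well-chosen vertices of `G` puts it near the centre of gravity of `G`,
so that the average distance from the hub is about half the average resistance. -/
theorem Connected.exists_isHubBound {G : Multigraph V} (hG : G.Connected) {t : ℕ} (ht : 0 < t) :
    ∃ (c : V → ℕ) (D : V → ℝ), ∑ x, c x = t ∧ G.IsHubBound c D ∧
      ∑ x, D x ≤ G.totalRes / (2 * Fintype.card V) * (1 + 1 / t) + Fintype.card V / t := by
  have hne := hG.nonempty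
  have hn : (0 : ℝ) < Fintype.card V := by exact_mod_cast Fintype.card_pos
  have ht' : (0 : ℝ) < t := by exact_mod_cast ht
  obtain ⟨M, hM⟩ := hG.exists_isGreen
  obtain ⟨c, hc, hQ⟩ := hM.exists_sample t
  have hc' : ∑ x, (c x : ℝ) = t := by exact_mod_cast hc
  set Q := ∑ x, ∑ y, (c x : ℝ) * c y * M x y with hQdef
  set d : V → V → ℝ := fun x y => (if y = x then 1 else 0) - c y / t with hd
  have hd0 : ∀ x, ∑ y, d x y = 0 := by
    intro x
    simp only [hd, Finset.sum_sub_distrib, ← Finset.sum_div, hc']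
    simp [ht'.ne']
  have hq : ∀ x, ∑ y, ∑ z, d x y * d x z * M y z =
      M x x - 2 / t * (∑ y, (c y : ℝ) * M x y) + Q / t ^ 2 := by
    intro x
    have h1 : ∀ y z, d x y * d x z * M y z =
        (if y = x then if z = x then M y z else 0 else 0) - (if y = x then c z / t * M y z else 0)
        - (if z = x then c y / t * M y z else 0) + (c y : ℝ) * c z * M y z / t ^ 2 := by
      intro y z
      by_cases h1 : y = x <;> by_cases h2 : z = x <;> simp [hd, h1, h2] <;> ring
    simp only [h1, Finset.sum_add_distrib, Finset.sum_sub_distrib, Finset.sum_ite_irrel,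
      Finset.sum_const_zero, Finset.sum_ite_eq', Finset.mem_univ, if_true, ← Finset.sum_div,
      ← hQdef]
    have h2 : ∑ y, (c y : ℝ) / t * M x y = 1 / t * ∑ y, (c y : ℝ) * M x y := by
      rw [Finset.mul_sum]
      exact Finset.sum_congr rfl fun y _ => by ring
    have h3 : ∑ y, (c y : ℝ) / t * M y x = 1 / t * ∑ y, (c y : ℝ) * M x y := by
      rw [← h2]
      exact Finset.sum_congr rfl fun y _ => by rw [hM.symm]
    rw [h2, h3]
    ring
  refine ⟨c, fun x => (∑ y, ∑ z, d x y * d x z * M y z) + 1 / t, hc, ⟨fun x => ?_, fun x f => ?_⟩,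
    ?_⟩
  · have := hM.quadForm_nonneg (hd0 x)
    positivity
  · have hq0 := hM.quadForm_nonneg (hd0 x)
    have h1 := hM.sq_sum_mul_le (hd0 x) f
    have hE := G.energy_nonneg f
    set q := ∑ y, ∑ z, d x y * d x z * M y z
    set S := ∑ y, (c y : ℝ) * f y ^ 2 with hS
    have hS0 : 0 ≤ S := by positivity
    have h2 : (1 / t * ∑ y, (c y : ℝ) * f y) ^ 2 ≤ 1 / t * S := by
      have := Finset.sum_sq_le_sum_mul_sum_of_sq_le_mul (Finset.univ : Finset V)
        (r := fun y => (c y : ℝ) * f y) (f := fun y => (c y : ℝ))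
        (g := fun y => (c y : ℝ) * f y ^ 2) (fun _ _ => by positivity) (fun _ _ => by positivity)
        (fun _ _ => le_of_eq (by ring))
      rw [hc', ← hS] at this
      rw [mul_pow]
      calc (1 / (t : ℝ)) ^ 2 * (∑ y, (c y : ℝ) * f y) ^ 2 ≤ (1 / (t : ℝ)) ^ 2 * (t * S) := by gcongr
        _ = 1 / t * S := by field_simp
    have h3 : f x = ∑ y, d x y * f y + 1 / t * ∑ y, (c y : ℝ) * f y := by
      simp only [hd, sub_mul, Finset.sum_sub_distrib, Finset.mul_sum]
      simp only [ite_mul, one_mul, zero_mul, Finset.sum_ite_eq', Finset.mem_univ, if_true]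
      have : ∑ y, (c y : ℝ) / t * f y = ∑ y, 1 / (t : ℝ) * (c y * f y) :=
        Finset.sum_congr rfl fun y _ => by ring
      rw [this]
      ring
    set a := ∑ y, d x y * f y
    set b := 1 / t * ∑ y, (c y : ℝ) * f y
    set r : ℝ := 1 / t with hr
    have hr0 : 0 ≤ r := by positivity
    rw [h3]
    have h6 : |2 * (a * b)| ≤ q * S + r * G.energy f := by
      refine abs_le_of_sq_le_sq ?_ (by positivity)
      have := mul_le_mul h1 h2 (sq_nonneg b) (by positivity)
      nlinarith [sq_nonneg (q * S - r * G.energy f)]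
    have h7 := le_abs_self (2 * (a * b))
    nlinarith
  · simp only [hq, Finset.sum_add_distrib, Finset.sum_sub_distrib, ← Finset.mul_sum]
    have h0 : ∑ x, ∑ y, (c y : ℝ) * M x y = 0 := by
      rw [Finset.sum_comm]
      refine Finset.sum_eq_zero fun y _ => ?_
      rw [← Finset.mul_sum, Finset.sum_congr rfl fun x _ => hM.symm x y, hM.sum_eq_zero, mul_zero]
    rw [h0, hM.totalRes_eq]
    simp only [Finset.sum_const, Finset.card_univ, nsmul_eq_mul]
    have h1 : (Fintype.card V : ℝ) * (Q / t ^ 2) ≤ (∑ x, M x x) / t := by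
      calc (Fintype.card V : ℝ) * (Q / t ^ 2)
          ≤ Fintype.card V * (t * ((∑ x, M x x) / Fintype.card V) / t ^ 2) := by gcongr
        _ = (∑ x, M x x) / t := by field_simp
    have h2 : 2 * (Fintype.card V : ℝ) * (∑ x, M x x) / (2 * Fintype.card V) * (1 + 1 / t) =
        ∑ x, M x x + (∑ x, M x x) / t := by field_simp
    have h3 : (Fintype.card V : ℝ) * (1 / t) = Fintype.card V / t := by ring
    rw [h2, h3]
    linarith

end Sampling

/-! ### Renaming the vertices -/

section Relabel

variable {V W : Type*} (e : W ≃ V)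

/-- The graph `G` with its vertices renamed. -/
def relabel (G : Multigraph V) : Multigraph W where
  mult x y := G.mult (e x) (e y)
  symm _ _ := G.symm _ _
  loopless _ := G.loopless _

variable [Fintype V] [Fintype W]

theorem relabel_degSum (G : Multigraph V) : (G.relabel e).degSum = G.degSum := by
  simp only [degSum, relabel]
  rw [← e.sum_comp]
  exact Finset.sum_congr rfl fun x _ => e.sum_comp (fun y => G.mult (e x) y)

variable [DecidableEq V] [DecidableEq W]

theorem IsUnitPotential.relabel {G : Multigraph V} {x y : W} {P : V → ℝ}
    (hP : G.IsUnitPotential (e x) (e y) P) :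
    (G.relabel e).IsUnitPotential x y (fun u => P (e u)) := by
  intro u
  have h := hP (e u)
  simp only [EmbeddingLike.apply_eq_iff_eq] at h
  rw [← h, ← e.sum_comp]
  rfl

theorem Connected.relabel {G : Multigraph V} (hG : G.Connected) : (G.relabel e).Connected := by
  obtain ⟨v⟩ := hG.nonempty
  have hne : Nonempty W := ⟨e.symm v⟩
  refine connected_of_isUnitPotential fun x y => ?_
  obtain ⟨P, hP⟩ := hG.exists_isUnitPotential (e x) (e y)
  exact ⟨_, hP.relabel e⟩

theorem Connected.relabel_totalRes {G : Multigraph V} (hG : G.Connected) :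
    (G.relabel e).totalRes = G.totalRes := by
  have h : ∀ x y, (G.relabel e).effRes x y = G.effRes (e x) (e y) := by
    intro x y
    obtain ⟨P, hP⟩ := hG.exists_isUnitPotential (e x) (e y)
    rw [effRes_eq hP, effRes_eq (hP.relabel e)]
  simp only [totalRes, h]
  rw [← e.sum_comp (fun x => ∑ y, G.effRes x y)]
  exact Finset.sum_congr rfl fun x _ => e.sum_comp (fun y => G.effRes (e x) y)

end Relabel

/-! ### The averages and the sequence of minima -/

section Averages

variable {n : ℕ}

theorem two_mul_sum_Ioi {R : Type*} [CommSemiring R] (F : Fin n → Fin n → R)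
    (hs : ∀ x y, F x y = F y x) (h0 : ∀ x, F x x = 0) :
    2 * ∑ x, ∑ y ∈ Finset.Ioi x, F x y = ∑ x, ∑ y, F x y := by
  have h1 : ∑ x, ∑ y ∈ Finset.Ioi x, F x y = ∑ x, ∑ y, if x < y then F x y else 0 := by
    refine Finset.sum_congr rfl fun x _ => ?_
    rw [← Finset.sum_filter, Finset.filter_lt_eq_Ioi]
  have h2 : ∑ x, ∑ y ∈ Finset.Ioi x, F x y = ∑ x, ∑ y, if y < x then F x y else 0 := by
    rw [h1, Finset.sum_comm]
    exact Finset.sum_congr rfl fun x _ => Finset.sum_congr rfl fun y _ => by rw [hs]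
  rw [two_mul]
  nth_rewrite 1 [h1]
  rw [h2, ← Finset.sum_add_distrib]
  refine Finset.sum_congr rfl fun x _ => ?_
  rw [← Finset.sum_add_distrib]
  refine Finset.sum_congr rfl fun y _ => ?_
  rcases lt_trichotomy x y with h | rfl | h
  · simp [h, h.not_gt]
  · simp [h0]
  · simp [h, h.not_gt]

theorem two_mul_numEdges (G : Multigraph (Fin n)) : 2 * G.numEdges = G.degSum :=
  two_mul_sum_Ioi _ G.symm G.loopless

theorem avgRes'_eq (G : Multigraph (Fin n)) : G.avgRes' = G.totalRes / (n : ℝ) ^ 2 := rfl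

theorem Connected.avgRes_eq {G : Multigraph (Fin n)} (hG : G.Connected) :
    G.avgRes = G.totalRes / (n * (n - 1)) := by
  have h1 : 2 * ∑ x, ∑ y ∈ Finset.Ioi x, G.effRes x y = G.totalRes :=
    two_mul_sum_Ioi _ hG.effRes_comm hG.effRes_self
  rw [avgRes, Nat.cast_choose_two, ← h1, div_div_eq_mul_div, mul_comm]

theorem admissible_iff {α : ℝ} {G : Multigraph (Fin n)} :
    G.Admissible α ↔ G.Connected ∧ (G.degSum : ℝ) ≤ α * n := by
  have h : (2 : ℝ) * G.numEdges = G.degSum := by exact_mod_cast G.two_mul_numEdges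
  unfold Admissible
  constructor <;> rintro ⟨h1, h2⟩ <;> exact ⟨h1, by linarith⟩

theorem bddBelow_avgRes' (n : ℕ) (α : ℝ) :
    BddBelow {r | ∃ G : Multigraph (Fin n), G.Admissible α ∧ G.avgRes' = r} := by
  refine ⟨0, ?_⟩
  rintro r ⟨G, hG, rfl⟩
  have := hG.1.totalRes_nonneg
  rw [avgRes'_eq]
  positivity

theorem aSeq_nonneg (n : ℕ) (α : ℝ) : 0 ≤ aSeq n α := by
  refine Real.sInf_nonneg ?_
  rintro r ⟨G, hG, rfl⟩
  have := hG.1.totalRes_nonneg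
  rw [avgRes'_eq]
  positivity

theorem Connected.aSeq_le {V : Type*} [Fintype V] [DecidableEq V] {G : Multigraph V}
    (hG : G.Connected) (hV : Fintype.card V = n) {α : ℝ} (hα : (G.degSum : ℝ) ≤ α * n) :
    aSeq n α ≤ G.totalRes / (n : ℝ) ^ 2 := by
  have e : Fin n ≃ V := (Fintype.equivFinOfCardEq hV).symm
  refine csInf_le (bddBelow_avgRes' n α) ⟨G.relabel e, admissible_iff.2 ⟨hG.relabel e, ?_⟩, ?_⟩
  · rwa [relabel_degSum]
  · rw [avgRes'_eq, hG.relabel_totalRes]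

theorem IsHubBound.aSeq_le {V : Type*} [Fintype V] [DecidableEq V] {H : Multigraph V} {c : V → ℕ}
    {D : V → ℝ} (hD : H.IsHubBound c D) {k l : ℕ} (hn : k * Fintype.card V + 1 + l = n) {α : ℝ}
    (hα : (k : ℝ) * (H.degSum + 2 * ∑ x, (c x : ℝ)) + 2 * l ≤ α * n) :
    aSeq n α ≤ 2 * (n + Fintype.card V + 1) * (k * ∑ x, D x + l) / (n : ℝ) ^ 2 := by
  refine (hD.connected (k := k) (l := l)).aSeq_le ?_ ?_ |>.trans ?_
  · simp only [Fintype.card_option, Fintype.card_sum, Fintype.card_prod, Fintype.card_fin]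
    omega
  · rw [hubGraph_degSum]
    push_cast
    exact hα
  · have := hD.totalRes_le (k := k) (l := l)
    rw [hn] at this
    gcongr

/-- The empty block: the corresponding hub graph is a star. -/
theorem isHubBound_empty : IsHubBound (V := Fin 0) ⟨fun _ _ => 0, fun _ _ => rfl, fun _ => rfl⟩
    (fun _ => 0) (fun _ => 0) :=
  ⟨fun x => x.elim0, fun x => x.elim0⟩

theorem exists_admissible (hn : 0 < n) {α : ℝ} (hα : 2 ≤ α) :
    ∃ G : Multigraph (Fin n), G.Admissible α := by
  obtain ⟨l, rfl⟩ : ∃ l, n = 1 + l := ⟨n - 1, by omega⟩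
  have e : Fin (1 + l) ≃ Option ((Fin 0 × Fin 0) ⊕ Fin l) :=
    (Fintype.equivFinOfCardEq (by simp [add_comm])).symm
  have hc := (isHubBound_empty.connected (k := 0) (l := l)).relabel e
  refine ⟨_, admissible_iff.2 (And.intro hc ?_)⟩
  rw [relabel_degSum, hubGraph_degSum]
  push_cast
  have : (0 : ℝ) ≤ l := Nat.cast_nonneg l
  nlinarith

theorem aSeq_le_two (hn : 0 < n) {α : ℝ} (hα : 2 ≤ α) : aSeq n α ≤ 2 := by
  obtain ⟨l, rfl⟩ : ∃ l, n = 1 + l := ⟨n - 1, by omega⟩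
  have hl : (0 : ℝ) ≤ l := Nat.cast_nonneg l
  refine (isHubBound_empty.aSeq_le (k := 0) (l := l) (α := α) (by simp) ?_).trans ?_
  · push_cast
    nlinarith
  · push_cast
    rw [div_le_iff₀ (by positivity)]
    simp
    nlinarith

theorem exists_totalRes_lt (hn : 0 < n) {α r : ℝ} (hα : 2 ≤ α) (hr : aSeq n α < r) :
    ∃ G : Multigraph (Fin n), G.Connected ∧ (G.degSum : ℝ) ≤ α * n ∧
      G.totalRes / (n : ℝ) ^ 2 < r := by
  obtain ⟨G₀, hG₀⟩ := exists_admissible hn hα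
  have hne : {r | ∃ G : Multigraph (Fin n), G.Admissible α ∧ G.avgRes' = r}.Nonempty :=
    ⟨_, G₀, hG₀, rfl⟩
  obtain ⟨_, ⟨G, hG, rfl⟩, hlt⟩ := exists_lt_of_csInf_lt hne hr
  rw [admissible_iff] at hG
  exact ⟨G, hG.1, hG.2, hlt⟩

theorem aSeq_anti (hn : 0 < n) {α β : ℝ} (hα : 2 ≤ α) (hαβ : α ≤ β) : aSeq n β ≤ aSeq n α := by
  obtain ⟨G₀, hG₀⟩ := exists_admissible hn hα
  refine csInf_le_csInf (bddBelow_avgRes' n β) ⟨_, G₀, hG₀, rfl⟩ ?_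
  rintro r ⟨G, hG, rfl⟩
  exact ⟨G, ⟨hG.1, hG.2.trans (by gcongr)⟩, rfl⟩

end Averages

open Filter Topology

/-! ### Existence of the limit -/

section Limit

/-- From one good graph on `n` vertices, many copies of it joined through a hub give good graphs of
every large order. Spare leaves at the hub pay for the edges to the hub. -/
theorem Connected.eventually_aSeq_le {n : ℕ} {H : Multigraph (Fin n)} (hH : H.Connected) {α : ℝ}
    (hα : 3.83 ≤ α) (he : (H.degSum : ℝ) ≤ α * n) {t : ℕ} (ht : 0 < t) {r : ℝ}
    (hr : H.totalRes / (n : ℝ) ^ 2 * (1 + 1 / t) + 2 / t + 4 * t / n < r) :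
    ∀ᶠ N : ℕ in atTop, aSeq N α ≤ r := by
  have hn : 0 < n := by
    have := hH.nonempty
    exact Fin.pos_iff_nonempty.2 this
  have hn' : (0 : ℝ) < n := by exact_mod_cast hn
  have ht' : (0 : ℝ) < t := by exact_mod_cast ht
  obtain ⟨c, D, hc, hD, hS⟩ := hH.exists_isHubBound ht
  rw [Fintype.card_fin] at hS
  have hc' : ∑ x, (c x : ℝ) = t := by exact_mod_cast hc
  have hS0 : 0 ≤ ∑ x, D x := Finset.sum_nonneg fun x _ => hD.nonneg x
  set S := ∑ x, D x
  have hlim : Tendsto (fun N : ℕ => (1 + ((n : ℝ) + 1) / N) *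
      (2 * S / n + 4 * t / n + 2 * (n + 2 * t) / N)) atTop
      (𝓝 ((1 + 0) * (2 * S / n + 4 * t / n + 0))) :=
    (tendsto_const_nhds.add (tendsto_const_div_atTop_nhds_zero_nat _)).mul
      (tendsto_const_nhds.add (tendsto_const_div_atTop_nhds_zero_nat _))
  have hlt : (1 + 0) * (2 * S / n + 4 * t / n + 0) < r := by
    have : 2 * S / n ≤ H.totalRes / (n : ℝ) ^ 2 * (1 + 1 / t) + 2 / t := by
      calc 2 * S / n ≤ 2 * (H.totalRes / (2 * n) * (1 + 1 / t) + n / t) / n := by gcongr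
        _ = _ := by field_simp
    linarith
  filter_upwards [hlim.eventually_lt_const hlt, eventually_ge_atTop 1] with N hN hN1
  refine le_trans ?_ hN.le
  set b := n + 2 * t with hb
  set k := (N - 1) / b with hk
  set l := N - 1 - k * n with hl
  have hkb : k * b ≤ N - 1 := Nat.div_mul_le_self _ _
  have hlt2 : N - 1 < (k + 1) * b := by
    have := Nat.lt_mul_div_succ (N - 1) (show 0 < b by omega)
    rw [mul_comm]
    exact this
  have hkb' : k * b = k * n + k * (2 * t) := by rw [hb]; ring
  have hlt3 : (k + 1) * b = k * n + k * (2 * t) + (n + 2 * t) := by rw [hb]; ring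
  have hNl : k * n + 1 + l = N := by omega
  have hl1 : k * (2 * t) ≤ l := by omega
  have hl2 : l ≤ k * (2 * t) + (n + 2 * t) := by omega
  have hl1' : (k : ℝ) * (2 * t) ≤ l := by exact_mod_cast hl1
  have hl2' : (l : ℝ) ≤ k * (2 * t) + (n + 2 * t) := by exact_mod_cast hl2
  have hNl' : (k : ℝ) * n + 1 + l = N := by exact_mod_cast hNl
  have hl0 : (0 : ℝ) ≤ l := Nat.cast_nonneg l
  have hk0 : (0 : ℝ) ≤ k := Nat.cast_nonneg k
  have hN0 : (0 : ℝ) < N := by exact_mod_cast hN1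
  refine (hD.aSeq_le (k := k) (l := l) (n := N) (by rw [Fintype.card_fin]; exact hNl) ?_).trans ?_
  · rw [hc', ← hNl']
    have h1 := mul_le_mul_of_nonneg_left he hk0
    have h2 := mul_le_mul_of_nonneg_right hα hl0
    nlinarith
  · rw [Fintype.card_fin]
    have h1 : (k : ℝ) * S + l ≤ N * (S / n + 2 * t / n + (n + 2 * t) / N) := by
      have h2 : (k : ℝ) ≤ N / n := by
        rw [le_div_iff₀ hn']
        linarith
      calc (k : ℝ) * S + l ≤ k * (S + 2 * t) + (n + 2 * t) := by linarith
        _ ≤ N / n * (S + 2 * t) + (n + 2 * t) := by gcongr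
        _ = _ := by field_simp
    calc 2 * ((N : ℝ) + n + 1) * (k * S + l) / (N : ℝ) ^ 2
        ≤ 2 * ((N : ℝ) + n + 1) * (N * (S / n + 2 * t / n + (n + 2 * t) / N)) / (N : ℝ) ^ 2 := by
          gcongr
      _ = _ := by
          field_simp
          ring

/-- The minima for large orders do not exceed the minimum for order `n` by more than `ε`, with a bound
on `n` that does not depend on `α`. -/
theorem exists_forall_eventually_aSeq_le {ε : ℝ} (hε : 0 < ε) :
    ∃ n₀ : ℕ, 0 < n₀ ∧ ∀ n, n₀ ≤ n → ∀ α : ℝ, 3.83 ≤ α →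
      ∀ᶠ N : ℕ in atTop, aSeq N α ≤ aSeq n α + ε := by
  obtain ⟨t, ht⟩ := exists_nat_gt (20 / ε + 1)
  have ht1 : (1 : ℝ) < t := by
    have : 0 < 20 / ε := by positivity
    linarith
  have ht0 : 0 < t := by
    have : (0 : ℝ) < t := by linarith
    exact_mod_cast this
  have htε : 20 < ε * t := by
    have h1 : 20 / ε < t := by linarith
    rw [div_lt_iff₀ hε] at h1
    linarith
  obtain ⟨n₀, hn₀⟩ := exists_nat_gt (20 * t / ε)
  have hn₀' : (0 : ℝ) < n₀ := lt_trans (by positivity) hn₀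
  refine ⟨n₀, by exact_mod_cast hn₀', fun n hn α hα => ?_⟩
  have hnn : (n₀ : ℝ) ≤ n := by exact_mod_cast hn
  have hn' : (0 : ℝ) < n := by linarith
  have hn0 : 0 < n := by exact_mod_cast hn'
  obtain ⟨H, hH, he, hA⟩ := exists_totalRes_lt hn0 (α := α) (r := aSeq n α + ε / 4)
    (by linarith) (by linarith)
  refine hH.eventually_aSeq_le hα he ht0 ?_
  have h2 := aSeq_le_two hn0 (α := α) (by linarith)
  have h3 : 4 * (t : ℝ) / n < ε / 5 := by
    rw [div_lt_iff₀ hε] at hn₀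
    rw [div_lt_iff₀ hn']
    nlinarith
  have h4 : 4 / (t : ℝ) < ε / 5 := by
    rw [div_lt_iff₀ (by linarith)]
    linarith
  have h5 : ε / 4 * (1 / (t : ℝ)) ≤ ε / 4 := by
    have : 1 / (t : ℝ) ≤ 1 := by
      rw [div_le_one (by linarith)]
      exact ht1.le
    nlinarith
  have h6 : H.totalRes / (n : ℝ) ^ 2 * (1 / t) ≤ (2 + ε / 4) * (1 / t) := by
    gcongr
    linarith
  have h7 : (2 + ε / 4) * (1 / (t : ℝ)) + 2 / t = 4 / t + ε / 4 * (1 / t) := by ring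
  rw [mul_add, mul_one]
  linarith

theorem tendsto_aSeq {α : ℝ} (hα : 3.83 ≤ α) :
    Tendsto (fun n : ℕ => aSeq n α) atTop (𝓝 (aLim α)) := by
  suffices h : ∃ L, Tendsto (fun n : ℕ => aSeq n α) atTop (𝓝 L) by
    obtain ⟨L, hL⟩ := h
    rw [aLim, hL.limUnder_eq]
    exact hL
  have hb1 : IsBoundedUnder (· ≥ ·) atTop fun n : ℕ => aSeq n α :=
    isBoundedUnder_of ⟨0, fun n => aSeq_nonneg n α⟩
  have hb2 : IsBoundedUnder (· ≤ ·) atTop fun n : ℕ => aSeq n α :=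
    ⟨2, eventually_map.2 <| (eventually_gt_atTop 0).mono fun n hn =>
      aSeq_le_two hn (by linarith)⟩
  set L := liminf (fun n : ℕ => aSeq n α) atTop with hL
  refine ⟨L, ?_⟩
  rw [tendsto_order]
  refine ⟨fun a ha => eventually_lt_of_lt_liminf ha hb1, fun a ha => ?_⟩
  obtain ⟨n₀, -, h0⟩ := exists_forall_eventually_aSeq_le (ε := (a - L) / 3) (by linarith)
  have hfr : ∃ᶠ n : ℕ in atTop, aSeq n α < L + (a - L) / 3 :=
    frequently_lt_of_liminf_lt hb2.isCoboundedUnder_ge (by linarith)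
  obtain ⟨n, hn1, hn2⟩ := (hfr.and_eventually (eventually_ge_atTop n₀)).exists
  filter_upwards [h0 n hn2 α hα] with N hN
  linarith

theorem exists_forall_aLim_le {ε : ℝ} (hε : 0 < ε) :
    ∃ n₀ : ℕ, 0 < n₀ ∧ ∀ n, n₀ ≤ n → ∀ α : ℝ, 3.83 ≤ α → aLim α ≤ aSeq n α + ε := by
  obtain ⟨n₀, h0, h⟩ := exists_forall_eventually_aSeq_le hε
  exact ⟨n₀, h0, fun n hn α hα => le_of_tendsto (tendsto_aSeq hα) (h n hn α hα)⟩

theorem aLim_nonneg {α : ℝ} (hα : 3.83 ≤ α) : 0 ≤ aLim α :=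
  ge_of_tendsto' (tendsto_aSeq hα) fun n => aSeq_nonneg n α

theorem aLim_anti {α β : ℝ} (hα : 3.83 ≤ α) (hαβ : α ≤ β) : aLim β ≤ aLim α :=
  le_of_tendsto_of_tendsto (tendsto_aSeq (hα.trans hαβ)) (tendsto_aSeq hα)
    ((eventually_gt_atTop 0).mono fun _ hn => aSeq_anti hn (by linarith) hαβ)

end Limit

/-! ### Wheels -/

section Wheel

/-- The cycle of length six. -/
def hexagon : Multigraph (Fin 6) where
  mult x y := if y = x + 1 ∨ x = y + 1 then 1 else 0
  symm x y := if_congr or_comm rfl rfl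
  loopless := by decide

theorem hexagon_energy (f : Fin 6 → ℝ) : hexagon.energy f =
    (f 0 - f 1) ^ 2 + (f 1 - f 2) ^ 2 + (f 2 - f 3) ^ 2 + (f 3 - f 4) ^ 2 + (f 4 - f 5) ^ 2 +
      (f 5 - f 0) ^ 2 := by
  simp only [energy, hexagon, Fin.sum_univ_six, Fin.isValue]
  simp +decide
  ring

/-- In the wheel with six spokes the resistance between the hub and a rim vertex is `9 / 20`. -/
theorem isHubBound_hexagon : hexagon.IsHubBound (fun _ => 1) (fun _ => 9 / 20) := by
  -- The potentials along the rim are proportional to `18, 7, 3, 2, 3, 7`, those of a unit current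
  -- from the rim vertex `x` to the hub; the difference of the two sides is the energy of what
  -- remains of `f` after subtracting the multiple of this potential that agrees with it at `x`.
  have key : ∀ a b c d e g : ℝ, a ^ 2 ≤ 9 / 20 * ((a - b) ^ 2 + (b - c) ^ 2 + (c - d) ^ 2 +
      (d - e) ^ 2 + (e - g) ^ 2 + (g - a) ^ 2 +
      (a ^ 2 + b ^ 2 + c ^ 2 + d ^ 2 + e ^ 2 + g ^ 2)) := by
    intro a b c d e g
    have h : 0 ≤ (b - a * 7 / 18) ^ 2 + (c - a * 3 / 18) ^ 2 + (d - a * 2 / 18) ^ 2 +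
        (e - a * 3 / 18) ^ 2 + (g - a * 7 / 18) ^ 2 + (b - a * 7 / 18) ^ 2 +
        ((b - a * 7 / 18) - (c - a * 3 / 18)) ^ 2 + ((c - a * 3 / 18) - (d - a * 2 / 18)) ^ 2 +
        ((d - a * 2 / 18) - (e - a * 3 / 18)) ^ 2 + ((e - a * 3 / 18) - (g - a * 7 / 18)) ^ 2 +
        (g - a * 7 / 18) ^ 2 := by positivity
    linarith
  refine ⟨fun _ => by norm_num, fun x f => ?_⟩
  rw [hexagon_energy]
  simp only [Fin.sum_univ_six, Nat.cast_one, one_mul]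
  fin_cases x <;> simp only [Fin.isValue, Fin.reduceFinMk, Fin.zero_eta, Fin.mk_one]
  · linarith [key (f 0) (f 1) (f 2) (f 3) (f 4) (f 5)]
  · linarith [key (f 1) (f 2) (f 3) (f 4) (f 5) (f 0)]
  · linarith [key (f 2) (f 3) (f 4) (f 5) (f 0) (f 1)]
  · linarith [key (f 3) (f 4) (f 5) (f 0) (f 1) (f 2)]
  · linarith [key (f 4) (f 5) (f 0) (f 1) (f 2) (f 3)]
  · linarith [key (f 5) (f 0) (f 1) (f 2) (f 3) (f 4)]

theorem hexagon_degSum : hexagon.degSum = 12 := by decide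

/-- With `61` wheels on six spokes for every `34` leaves, all sharing the hub, the average degree
is `3.83` and the average resistance is `0.9935`. -/
theorem aLim_le {α : ℝ} (hα : 3.83 ≤ α) : aLim α ≤ 0.994 := by
  have hsub : Tendsto (fun j : ℕ => 400 * j + 1) atTop atTop :=
    tendsto_atTop_mono (fun j : ℕ => show j ≤ 400 * j + 1 by omega) tendsto_id
  refine le_of_tendsto ((tendsto_aSeq hα).comp hsub) ?_
  filter_upwards [eventually_ge_atTop 100] with j hj
  have hj' : (100 : ℝ) ≤ j := by exact_mod_cast hj
  refine (isHubBound_hexagon.aSeq_le (k := 61 * j) (l := 34 * j) ?_ ?_).trans ?_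
  · simp only [Fintype.card_fin]
    ring
  · rw [hexagon_degSum]
    simp only [Finset.sum_const, Finset.card_univ, Fintype.card_fin]
    push_cast
    norm_num at hα ⊢
    nlinarith
  · simp only [Finset.sum_const, Finset.card_univ, Fintype.card_fin]
    push_cast
    rw [div_le_iff₀ (by positivity)]
    norm_num
    nlinarith

end Wheel

/-! ### Comparison of graphs with different numbers of edges and leaves -/

section Comparison

/-- Edges can be deleted until the average degree is `α`, with control over the growth of the total
resistance. -/
theorem Connected.exists_degSum_le {V : Type*} [Fintype V] [DecidableEq V] {G : Multigraph V}
    (hG : G.Connected) {α B : ℝ} (hα : 2 ≤ α) (hB : (G.degSum : ℝ) ≤ B)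
    (hαB : α * Fintype.card V ≤ B) :
    ∃ H : Multigraph V, H.Connected ∧ (H.degSum : ℝ) ≤ α * Fintype.card V ∧
      H.totalRes * ((α / 2 - 1) * Fintype.card V + 1) ≤
        G.totalRes * (B / 2 - Fintype.card V + 2) := by
  have hm : (0 : ℝ) ≤ Fintype.card V := Nat.cast_nonneg _
  have hT := hG.totalRes_nonneg
  rcases le_or_gt (G.degSum : ℝ) (α * Fintype.card V) with hle | hgt
  · exact ⟨G, hG, hle, mul_le_mul_of_nonneg_left (by linarith) hT⟩
  · have h1 := Nat.le_ceil (((G.degSum : ℝ) - α * Fintype.card V) / 2)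
    have h2 := Nat.ceil_lt_add_one (a := ((G.degSum : ℝ) - α * Fintype.card V) / 2) (by linarith)
    set k := ⌈((G.degSum : ℝ) - α * Fintype.card V) / 2⌉₊
    have h3 : 2 * (Fintype.card V : ℝ) ≤ α * Fintype.card V := by gcongr
    obtain ⟨H, hH, hd, hHT⟩ := hG.exists_deleteEdges k (by linarith)
    have hd' : (H.degSum : ℝ) + 2 * k = G.degSum := by exact_mod_cast hd
    refine ⟨H, hH, by linarith, ?_⟩
    calc H.totalRes * ((α / 2 - 1) * Fintype.card V + 1)
        ≤ H.totalRes * ((H.degSum : ℝ) / 2 - Fintype.card V + 2) :=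
          mul_le_mul_of_nonneg_left (by linarith) hH.totalRes_nonneg
      _ ≤ G.totalRes * ((G.degSum : ℝ) / 2 - Fintype.card V + 2) := hHT
      _ ≤ _ := mul_le_mul_of_nonneg_left (by linarith) hT

theorem aSeq_mul_le {n : ℕ} (hn : 0 < n) {α β : ℝ} (hα : 3.83 ≤ α) (hαβ : α ≤ β) :
    aSeq n α * ((α / 2 - 1) * n + 1) ≤ aSeq n β * ((β / 2 - 1) * n + 2) := by
  have hn' : (0 : ℝ) < n := by exact_mod_cast hn
  have hpα : 0 < (α / 2 - 1) * n + 1 := by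
    have : 0 < (α / 2 - 1) * n := mul_pos (by linarith) hn'
    linarith
  have hpβ : 0 < (β / 2 - 1) * n + 2 := by
    have : 0 < (β / 2 - 1) * n := mul_pos (by linarith) hn'
    linarith
  rw [← div_le_iff₀ hpβ]
  refine le_of_forall_gt fun r hr => ?_
  obtain ⟨G, hG, hd, hlt⟩ := exists_totalRes_lt hn (by linarith) hr
  refine lt_of_le_of_lt ?_ hlt
  obtain ⟨H, hH, hdH, hT⟩ := hG.exists_degSum_le (α := α) (by linarith) hd
    (by rw [Fintype.card_fin]; gcongr)
  rw [Fintype.card_fin] at hdH hT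
  have h1 := hH.aSeq_le (Fintype.card_fin n) hdH
  rw [div_le_iff₀ hpβ]
  calc aSeq n α * ((α / 2 - 1) * n + 1)
      ≤ H.totalRes / (n : ℝ) ^ 2 * ((α / 2 - 1) * n + 1) := by gcongr
    _ = H.totalRes * ((α / 2 - 1) * n + 1) / (n : ℝ) ^ 2 := by ring
    _ ≤ G.totalRes * (β * n / 2 - n + 2) / (n : ℝ) ^ 2 := by gcongr
    _ = _ := by ring

/-- `(α - 2) a(α)` is nondecreasing. Since `a` itself is nonincreasing, it is continuous. -/
theorem aLim_mul_le {α β : ℝ} (hα : 3.83 ≤ α) (hαβ : α ≤ β) :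
    aLim α * (α / 2 - 1) ≤ aLim β * (β / 2 - 1) := by
  have h1 : Tendsto (fun n : ℕ => aSeq n α * ((α / 2 - 1) + 1 / n)) atTop
      (𝓝 (aLim α * ((α / 2 - 1) + 0))) :=
    (tendsto_aSeq hα).mul (tendsto_const_nhds.add (tendsto_const_div_atTop_nhds_zero_nat 1))
  have h2 : Tendsto (fun n : ℕ => aSeq n β * ((β / 2 - 1) + 2 / n)) atTop
      (𝓝 (aLim β * ((β / 2 - 1) + 0))) :=
    (tendsto_aSeq (hα.trans hαβ)).mul
      (tendsto_const_nhds.add (tendsto_const_div_atTop_nhds_zero_nat 2))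
  rw [add_zero] at h1 h2
  refine le_of_tendsto_of_tendsto h1 h2 ((eventually_gt_atTop 0).mono fun n hn => ?_)
  have hn' : (0 : ℝ) < n := by exact_mod_cast hn
  have h3 := aSeq_mul_le hn hα hαβ
  calc aSeq n α * ((α / 2 - 1) + 1 / n) = aSeq n α * ((α / 2 - 1) * n + 1) / n := by field_simp
    _ ≤ aSeq n β * ((β / 2 - 1) * n + 2) / n := by gcongr
    _ = _ := by field_simp

theorem aLim_le_add {α β : ℝ} (hα : 3.83 ≤ α) (hαβ : α ≤ β) : aLim α ≤ aLim β + (β - α) := by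
  have h1 := aLim_mul_le hα hαβ
  have h2 := aLim_nonneg (hα.trans hαβ)
  have h3 := aLim_le (hα.trans hαβ)
  norm_num at hα h3
  nlinarith

/-- The convergence `a_n(α) → a(α)` is uniform from above: on bounded intervals because these are
monotone functions with a continuous limit, and near infinity because the limit is bounded below. -/
theorem exists_forall_aSeq_le {ε : ℝ} (hε : 0 < ε) :
    ∃ n₀ : ℕ, ∀ n, n₀ ≤ n → ∀ α : ℝ, 3.83 ≤ α → aSeq n α ≤ aLim α + ε := by
  set S : Set ℝ := aLim '' Set.Ici 3.83 with hS
  have hbdd : BddBelow S := ⟨0, by rintro _ ⟨β, hβ, rfl⟩; exact aLim_nonneg hβ⟩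
  obtain ⟨_, ⟨B, hB, rfl⟩, hlt⟩ := exists_lt_of_csInf_lt (s := S) (b := sInf S + ε / 2)
    ⟨_, 3.83, Set.self_mem_Ici, rfl⟩ (by linarith)
  have hB' : 3.83 ≤ B := hB
  set g : ℕ → ℝ := fun i => 3.83 + i * (ε / 2) with hg
  have hg0 : ∀ i, 3.83 ≤ g i := fun i => by
    have : 0 ≤ (i : ℝ) * (ε / 2) := by positivity
    simp only [hg]
    linarith
  obtain ⟨K, hK⟩ := exists_nat_gt ((B - 3.83) / (ε / 2))
  have hKB : B ≤ g K := by
    rw [div_lt_iff₀ (by linarith)] at hK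
    simp only [hg]
    linarith
  have hev : ∀ᶠ n : ℕ in atTop, ∀ i ∈ Finset.range (K + 1), aSeq n (g i) < aLim (g i) + ε / 2 :=
    (Finset.eventually_all _).2 fun i _ =>
      (tendsto_aSeq (hg0 i)).eventually_lt_const (by linarith)
  obtain ⟨n₀, hn₀⟩ := eventually_atTop.1 (hev.and (eventually_gt_atTop 0))
  refine ⟨n₀, fun n hn α hα => ?_⟩
  obtain ⟨hev, hn0⟩ := hn₀ n hn
  rcases le_or_gt (g K) α with hKα | hKα
  · have h1 := aSeq_anti hn0 (by linarith [hg0 K]) hKα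
    have h2 := hev K (Finset.self_mem_range_succ K)
    have h3 := aLim_anti hB' hKB
    have h4 : sInf S ≤ aLim α := csInf_le hbdd ⟨α, hα, rfl⟩
    linarith
  · have h0 : 0 ≤ (α - 3.83) / (ε / 2) := div_nonneg (by linarith) (by linarith)
    have hf1 := Nat.floor_le h0
    have hf2 := Nat.lt_floor_add_one ((α - 3.83) / (ε / 2))
    set i := ⌊(α - 3.83) / (ε / 2)⌋₊
    rw [le_div_iff₀ (by linarith)] at hf1
    rw [div_lt_iff₀ (by linarith)] at hf2
    have hiα : g i ≤ α := by
      simp only [hg]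
      linarith
    have hiK : i < K := by
      have : (i : ℝ) * (ε / 2) < K * (ε / 2) := by
        simp only [hg] at hKα
        linarith
      exact_mod_cast lt_of_mul_lt_mul_right this (by linarith)
    have h1 := aSeq_anti hn0 (by linarith [hg0 i]) hiα
    have h2 := hev i (Finset.mem_range.2 (by omega))
    have h3 := aLim_le_add (hg0 i) hiα
    simp only [hg] at h3 h2 h1
    linarith

/-- The lower bound for graphs with leaves. Removing the leaves leaves a core with `m = (1 - γ) n`
vertices and surplus edges; deleting these gives a graph to which the definition of `a(α)` applies,
whence `A(G) ≥ 2γ + (1 - γ)² a(α) + o(1)`, and `a(α) ≤ 0.994`. -/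
theorem exists_forall_avgRes_ge {ε : ℝ} (hε : 0 < ε) :
    ∃ N : ℕ, ∀ n : ℕ, N ≤ n → ∀ α : ℝ, 3.83 ≤ α → ∀ (γ : ℝ) (G : Multigraph (Fin n)),
      G.Connected → (G.degSum : ℝ) ≤ α * n → (G.numLeaves : ℝ) = γ * n →
        γ / 100 - ε ≤ G.avgRes - aLim α := by
  obtain ⟨n₀, -, hn₀⟩ := exists_forall_aLim_le (ε := ε / 4) (by linarith)
  obtain ⟨n₁, hn₁⟩ := exists_nat_gt (8 / ε)
  refine ⟨2 * n₀ + n₁ + 3, fun n hn α hα γ G hG hd hl => ?_⟩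
  have hnn : (2 : ℝ) * n₀ + n₁ + 3 ≤ n := by exact_mod_cast hn
  have hn0' : (0 : ℝ) ≤ n₀ := Nat.cast_nonneg _
  have hn1' : (0 : ℝ) ≤ n₁ := Nat.cast_nonneg _
  have hn' : (0 : ℝ) < n := by linarith
  have hV : 2 < Fintype.card (Fin n) := by rw [Fintype.card_fin]; omega
  have hγ : 0 ≤ γ := by
    have : 0 ≤ γ * n := by rw [← hl]; positivity
    exact nonneg_of_mul_nonneg_left this hn'
  have ha0 := aLim_nonneg hα
  have ha1 := aLim_le hα
  have hC := hG.core hV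
  have hT := hG.totalRes_ge hV
  have hdC : (G.core.degSum : ℝ) + 2 * G.numLeaves = G.degSum := by
    exact_mod_cast hG.core_degSum hV
  have hmℓ : (Fintype.card {x // G.degree x ≠ 1} : ℝ) + G.numLeaves = n := by
    have := card_leaf_add (G := G)
    rw [Fintype.card_fin] at this
    exact_mod_cast this
  have hm0 : 0 < Fintype.card {x // G.degree x ≠ 1} := by
    have := hG.core_nonempty hV
    exact Fintype.card_pos
  have hTC := hC.totalRes_nonneg
  rw [Fintype.card_fin, hl] at hT
  rw [hl] at hdC hmℓ
  set m : ℕ := Fintype.card {x // G.degree x ≠ 1} with hm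
  have hm0' : (0 : ℝ) < m := by exact_mod_cast hm0
  have hA : 2 * γ + G.core.totalRes / (m * n) ≤ G.avgRes := by
    have hn1 : (0 : ℝ) < n - 1 := by linarith
    rw [hG.avgRes_eq]
    calc 2 * γ + G.core.totalRes / (m * n) ≤ 2 * γ + G.core.totalRes / (m * (n - 1)) := by
          gcongr
          linarith
      _ = (G.core.totalRes * (n / m) + 2 * (γ * n) * (n - 1)) / (n * (n - 1)) := by
          field_simp
          ring
      _ ≤ _ := by gcongr
  rcases le_or_gt (1 / 2) γ with hγ2 | hγ2
  · have : 0 ≤ G.core.totalRes / (m * n) := by positivity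
    norm_num at ha1
    linarith
  · have hγn : γ * n < 1 / 2 * n := mul_lt_mul_of_pos_right hγ2 hn'
    have hγn0 : 0 ≤ γ * n := by positivity
    have hmn : (n : ℝ) < 2 * m := by linarith
    have hmn₀ : n₀ ≤ m := by
      have : (n₀ : ℝ) ≤ m := by linarith
      exact_mod_cast this
    obtain ⟨H, hH, hdH, hHT⟩ := hC.exists_degSum_le (α := α) (B := α * n - 2 * (γ * n))
      (by linarith) (by linarith) (by
        rw [← hm, show (m : ℝ) = n - γ * n by linarith]
        have := mul_le_mul_of_nonneg_right (show 2 ≤ α by linarith) hγn0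
        linarith)
    rw [← hm] at hdH hHT
    have h1 := (hn₀ m hmn₀ α hα).trans (add_le_add_left (hH.aSeq_le hm.symm hdH) _)
    set h := H.totalRes / (m : ℝ) ^ 2 with hh
    have hHh : H.totalRes = h * (m : ℝ) ^ 2 := by rw [hh]; field_simp
    set s := α / 2 - 1 with hs
    have hs0 : 1 / 2 ≤ s := by linarith
    have hq : (m : ℝ) = (1 - γ) * n := by linarith
    have hcoef : (α * n - 2 * (γ * n)) / 2 - m + 2 = s * n + 2 := by rw [hq, hs]; ring
    rw [hcoef, hHh] at hHT
    have hden : 0 < s * n + 2 := by positivity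
    set p := (s * m + 1) / (s * n + 2) with hp
    have hp1 : p ≤ 1 := by
      rw [hp, div_le_one hden]
      have : s * m ≤ s * n := by
        have : (m : ℝ) ≤ n := by linarith
        gcongr
      linarith
    have hp0 : 0 ≤ p := by positivity
    have hpq : 1 - γ - 2 / n ≤ p := by
      rw [hp, le_div_iff₀ hden, hq]
      have e1 : (1 - γ - 2 / n) * (s * n + 2) =
          s * ((1 - γ) * n) + 1 + (1 - 2 * γ) - 2 * s - 4 / n := by
        field_simp
        ring
      have e2 : 0 ≤ 4 / (n : ℝ) := by positivity
      rw [e1]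
      linarith
    have hlow : (1 - γ) * (p * h) ≤ G.core.totalRes / (m * n) := by
      rw [le_div_iff₀ (by positivity)]
      calc (1 - γ) * (p * h) * (m * n) = p * (h * ((1 - γ) * n * m)) := by ring
        _ = h * (m : ℝ) ^ 2 * (s * m + 1) / (s * n + 2) := by rw [← hq, hp]; ring
        _ ≤ G.core.totalRes := by rw [div_le_iff₀ hden]; exact hHT
    have hn2 : 2 / (n : ℝ) < ε / 4 := by
      rw [div_lt_iff₀ hε] at hn₁
      rw [div_lt_iff₀ hn']
      have := mul_le_mul_of_nonneg_right (show (n₁ : ℝ) ≤ n by linarith) hε.le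
      linarith
    set a := aLim α
    -- `(1 - γ) p h ≥ (1 - γ) p a - ε / 4 ≥ (1 - γ)² a - 2 / n - ε / 4`
    have hγ1 : 0 ≤ 1 - γ := by linarith
    have hqp0 : 0 ≤ (1 - γ) * p := mul_nonneg hγ1 hp0
    have hqp1 : (1 - γ) * p ≤ 1 := mul_le_one₀ (by linarith) hp0 hp1
    have k1 : (1 - γ) * p * a ≤ (1 - γ) * (p * h) + ε / 4 := by
      have e1 := mul_le_mul_of_nonneg_left h1 hqp0
      have e2 : (1 - γ) * p * (ε / 4) ≤ ε / 4 := mul_le_of_le_one_left (by linarith) hqp1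
      linarith
    have k2 : (1 - γ) * a * (1 - γ - 2 / n) ≤ (1 - γ) * a * p := by
      have := mul_nonneg hγ1 ha0
      gcongr
    norm_num at ha1
    have k3 : (1 - γ) * a ≤ 1 := mul_le_one₀ (by linarith) ha0 (by linarith)
    have k4 : (1 - γ) * a * (2 / n) ≤ 2 / n := mul_le_of_le_one_left (by positivity) k3
    have k5 : γ * a ≤ γ * (497 / 500) := by gcongr
    have k6 : 0 ≤ γ ^ 2 * a := by positivity
    have k7 : (1 - γ) * a * (1 - γ - 2 / n) =
        a - 2 * (γ * a) + γ ^ 2 * a - (1 - γ) * a * (2 / n) := by ring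
    have k8 : (1 - γ) * p * a = (1 - γ) * a * p := by ring
    linarith

end Comparison

end Multigraph

theorem lemma8p1 :
    -- the limit `a(α) = lim a_n(α)` exists
    (∀ α : ℝ, 3.83 ≤ α →
      Filter.Tendsto (fun n : ℕ => Multigraph.aSeq n α) Filter.atTop
        (nhds (Multigraph.aLim α))) ∧
    -- a graph with average degree `α` and `γ n` leaves has `A(G) - a(α) ≥ γ / 100 + o(1)`
    (∀ ε : ℝ, 0 < ε → ∃ N : ℕ, ∀ n : ℕ, N ≤ n → ∀ α : ℝ, 3.83 ≤ α →
      ∀ (γ : ℝ) (G : Multigraph (Fin n)), G.Connected → (G.numEdges : ℝ) ≤ α * n / 2 →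
        (G.numLeaves : ℝ) = γ * n → G.avgRes - Multigraph.aLim α ≥ γ / 100 - ε) ∧
    -- optimal graphs have `o(n)` leaves
    (∀ ε : ℝ, 0 < ε → ∃ N : ℕ, ∀ n : ℕ, N ≤ n → ∀ α : ℝ, 3.83 ≤ α →
      ∀ G : Multigraph (Fin n), G.IsOptimal α → (G.numLeaves : ℝ) ≤ ε * n) := by
  refine ⟨fun α hα => Multigraph.tendsto_aSeq hα, fun ε hε => ?_, fun ε hε => ?_⟩
  · obtain ⟨N, hN⟩ := Multigraph.exists_forall_avgRes_ge hε
    exact ⟨N, fun n hn α hα γ G hG he hl =>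
      hN n hn α hα γ G hG (Multigraph.admissible_iff.1 ⟨hG, he⟩).2 hl⟩
  · obtain ⟨N₁, hN₁⟩ := Multigraph.exists_forall_avgRes_ge (ε := ε / 400) (by positivity)
    obtain ⟨N₂, hN₂⟩ := Multigraph.exists_forall_aSeq_le (ε := ε / 400) (by positivity)
    obtain ⟨N₃, hN₃⟩ := exists_nat_gt (800 / ε)
    refine ⟨N₁ + N₂ + N₃ + 3, fun n hn α hα G hG => ?_⟩
    have hnn : (N₁ : ℝ) + N₂ + N₃ + 3 ≤ n := by exact_mod_cast hn
    have h1' : (0 : ℝ) ≤ N₁ := Nat.cast_nonneg _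
    have h2' : (0 : ℝ) ≤ N₂ := Nat.cast_nonneg _
    have h3' : (0 : ℝ) ≤ N₃ := Nat.cast_nonneg _
    have hn' : (0 : ℝ) < n := by linarith
    have hn1 : (0 : ℝ) < n - 1 := by linarith
    have hGc := hG.1.1
    have h1 := hN₁ n (by omega) α hα (G.numLeaves / n) G hGc (Multigraph.admissible_iff.1 hG.1).2
      (by field_simp)
    have h2 := hN₂ n (by omega) α hα
    have h3 := Multigraph.aLim_le hα
    norm_num at h3
    -- an optimal graph for `A` is also optimal for `A' = (1 - 1 / n) A`
    have h4 : G.avgRes * ((n - 1) / n) ≤ Multigraph.aSeq n α := by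
      refine le_csInf ⟨_, G, hG.1, rfl⟩ ?_
      rintro r ⟨H, hH, rfl⟩
      have h5 := hG.2 H hH
      rw [hH.1.avgRes_eq] at h5
      rw [Multigraph.avgRes'_eq]
      calc G.avgRes * ((n - 1) / n) ≤ H.totalRes / (n * (n - 1)) * ((n - 1) / n) := by gcongr
        _ = _ := by field_simp
    set l : ℝ := (G.numLeaves : ℝ)
    have h6 : G.avgRes * (n - 1) ≤ (Multigraph.aLim α + ε / 400) * n := by
      have := mul_le_mul_of_nonneg_right (h4.trans h2) hn'.le
      have e : G.avgRes * ((n - 1) / n) * n = G.avgRes * (n - 1) := by field_simp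
      linarith
    have h7 : 800 < ε * N₃ := by
      rw [div_lt_iff₀ hε] at hN₃
      linarith
    have h8 : G.avgRes ≤ Multigraph.aLim α + 2 * (ε / 400) := by
      have h9 : 800 + 2 * ε ≤ ε * (n - 1) := by nlinarith
      refine le_of_mul_le_mul_right (h6.trans ?_) hn1
      nlinarith
    have h10 : l / n ≤ ε := by linarith
    rwa [div_le_iff₀ hn'] at h10
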